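/- Let $\Delta\ge 3$ and $d=\Delta-1$, and let $\lambda>\lambda_c(\mathbb{T}_\Delta)=(\Delta-1)^{\Delta-1}/(\Delta-2)^{\Delta}$. The hard-core measure with activity $\lambda$ on a finite graph gives each independent set $I$ a probability proportional to $\lambda^{|I|}$. Let $\hat{\mathbb{T}}$ be the infinite $d$-ary tree with root $\rho$. For $\ell\ge 0$ let $\hat T_\ell$ be its finite subtree consisting of the levels $0,1,\dots,\ell$ (the root is level $0$), let $S_\ell$ be the set of vertices at level $\ell$, and let $q_\ell$ be the probability that $\rho$ is occupied under the hard-core measure on $\hat T_\ell$. Extend the hard-core measure on $\hat T_\ell$ to configurations in $\{0,1\}^{V(\hat{\mathbb{T}})}$ by declaring all other vertices vacant. Then the limits $q^+=\lim_{n\to\infty} q_{2n}$ and $q^-=\lim_{n\to\infty}q_{2n+1}$ exist, and the hard-core measures on $\hat T_{2n}$ and on $\hat T_{2n+1}$ converge weakly, as $n\to\infty$, to probability measures $\hat\mu^+$ and $\hat\mu^-$ respectively. For a random configuration $\hat X$ with law $\hat\mu^{+}$ (respectively $\hat\mu^-$), let $X_{\rho,\ell,+}$ (respectively $X_{\rho,\ell,-}$)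 be the probability that $\rho$ is occupied under the hard-core measure on $\hat T_\ell$ conditioned on agreeing with $\hat X$ on $S_\ell$; it is a random variable, being a function of $\hat X|_{S_\ell}$. There exist constants $\zeta_1,\zeta_2>0$, depending only on $\lambda$ and $\Delta$, such that for all sufficiently large $\ell$ $$\mathbb{P}\big[\,|X_{\rho,\ell,+}-q^+|\ge e^{-\zeta_1\ell}\,\big]\le \exp(-e^{\zeta_2\ell})\quad\text{and}\quad \mathbb{P}\big[\,|X_{\rho,\ell,-}-q^-|\ge e^{-\zeta_1\ell}\,\big]\le \exp(-e^{\zeta_2\ell}).$$ -/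

import Mathlib

open Filter Topology MeasureTheory
open scoped NNReal ENNReal

section HardCore

variable {V : Type*}

open Classical in
/-- The independent sets of the subgraph of `G` induced by the finite vertex set `Λ`. -/
noncomputable def indepSets (G : SimpleGraph V) (Λ : Finset V) : Finset (Finset V) :=
  Λ.powerset.filter fun I => G.IsIndepSet (I : Set V)

/-- The hard-core partition function `∑ I, lam ^ |I|` of the subgraph of `G` induced by `Λ`. -/
noncomputable def hardCoreZ (G : SimpleGraph V) (lam : ℝ≥0) (Λ : Finset V) : ℝ≥0 :=
  ∑ I ∈ indepSets G Λ, lam ^ I.card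

open Classical in
/-- The configuration (`true` is occupied, `false` is vacant) of a finite set of vertices. -/
noncomputable def occupation (I : Finset V) : V → Bool := fun v => decide (v ∈ I)

/-- The hard-core (Gibbs) measure with activity `lam` of the finite subgraph of `G` induced by `Λ`,
as a law on the configurations on all of `V` (every vertex outside `Λ` is vacant). -/
noncomputable def hardCoreMeasure (G : SimpleGraph V) (lam : ℝ≥0) (Λ : Finset V) :
    Measure (V → Bool) :=
  ∑ I ∈ indepSets G Λ,
    ((lam ^ I.card / hardCoreZ G lam Λ : ℝ≥0) : ℝ≥0∞) • Measure.dirac (occupation I)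

theorem hardCoreZ_pos (G : SimpleGraph V) (lam : ℝ≥0) (Λ : Finset V) : 0 < hardCoreZ G lam Λ := by
  classical
  have h : (∅ : Finset V) ∈ indepSets G Λ := by simp [indepSets, SimpleGraph.IsIndepSet]
  have h1 : lam ^ (∅ : Finset V).card ≤ hardCoreZ G lam Λ :=
    Finset.single_le_sum (f := fun I : Finset V => lam ^ I.card) (fun _ _ => zero_le) h
  exact lt_of_lt_of_le (by simp) h1

instance hardCoreMeasure_isProbabilityMeasure (G : SimpleGraph V) (lam : ℝ≥0) (Λ : Finset V) :
    IsProbabilityMeasure (hardCoreMeasure G lam Λ) := by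
  constructor
  have h := (hardCoreZ_pos G lam Λ).ne'
  simp only [hardCoreMeasure, Measure.coe_finsetSum, Finset.sum_apply, Measure.smul_apply,
    measure_univ, smul_eq_mul, mul_one]
  rw [← ENNReal.ofNNReal_finsetSum, ← Finset.sum_div]
  rw [show ∑ I ∈ indepSets G Λ, lam ^ I.card = hardCoreZ G lam Λ from rfl, div_self h]
  rfl

end HardCore

/-- The vertices of the infinite rooted `d`-ary tree: a vertex is the list of the choices of a child
on the path from the root; the root is `[]`, and the depth of a vertex is its length. -/
abbrev TreeVertex (d : ℕ) : Type := List (Fin d)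

/-- The infinite rooted `d`-ary tree; the children of `u` are the vertices `u ++ [i]`. -/
def dAryTree (d : ℕ) : SimpleGraph (TreeVertex d) :=
  SimpleGraph.fromRel fun u v => ∃ i : Fin d, v = u ++ [i]

/-- The vertices of depth at most `l`. -/
noncomputable def treeBall (d l : ℕ) : Finset (TreeVertex d) :=
  (List.finite_length_le (Fin d) l).toFinset

/-- The hard-core measure on the finite `d`-ary tree with levels `0, 1, …, l`. -/
noncomputable def treeGibbs (d : ℕ) (lam : ℝ≥0) (l : ℕ) : ProbabilityMeasure (TreeVertex d → Bool) :=
  ⟨hardCoreMeasure (dAryTree d) lam (treeBall d l), inferInstance⟩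

/-- The probability that the root is occupied under the hard-core measure on the finite `d`-ary tree
with levels `0, 1, …, l`. -/
noncomputable def rootMarginal (d : ℕ) (lam : ℝ≥0) (l : ℕ) : ℝ :=
  (treeGibbs d lam l : Measure (TreeVertex d → Bool)).real {τ | τ [] = true}

/-- The probability that the root is occupied under the hard-core measure on the finite `d`-ary tree
with levels `0, 1, …, l`, conditioned on agreeing with `σ` at all vertices of level `l`. -/
noncomputable def condRootMarginal (d : ℕ) (lam : ℝ≥0) (l : ℕ) (σ : TreeVertex d → Bool) : ℝ :=
  (ProbabilityTheory.cond (treeGibbs d lam l : Measure (TreeVertex d → Bool))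
    {τ | ∀ v : TreeVertex d, v.length = l → τ v = σ v}).real {τ | τ [] = true}

/-- The critical activity of the infinite `Δ`-regular tree. -/
noncomputable def criticalActivity (Δ : ℕ) : ℝ :=
  ((Δ : ℝ) - 1) ^ (Δ - 1) / ((Δ : ℝ) - 2) ^ Δ

/-! Work with the probability that the root is vacant. On the `d`-ary tree it satisfies the
decreasing recursion `u ↦ 1 / (1 + lam * u ^ d)`. Iterating from the extreme values 0 and 1 encloses
every conditional vacancy probability between two monotone sequences, with limits `α ≤ β` exchanged
by the recursion. Above the critical activity the fixed point is repelling, so `α < β`, and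
comparing the geometric, logarithmic and arithmetic means shows that this two-cycle is attracting
(`exists_cycle`, `cycle_attracting`). The free tree of height `L` realises an extreme boundary, so
its vacancy probability tends to `α` or `β` according to the parity of `L`.

Concentration comes in three stages, uniformly in the height `L ≥ l`. The conditional vacancy
probability has mean beyond the limit value, on the side of the pointwise bound that tends to that
value; Markov's inequality gives convergence in probability (`eventually_tailBound`). Next, branches
at the root are independent up to a factor `1 + lam`, so two bad branches cost the square of the bad
probability, while a single bad branch is forgotten after `K` levels because the logarithmic
recursion is a strict contraction in each argument (`exists_thresholds`). Hence the bad probability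
is essentially squared every `K` levels, which is doubly exponential decay
(`TailBound.doubly_exponential`). Finally half of the levels are spent shrinking the deviation
geometrically; the union bounds cost only an exponential factor (`exists_concentration`).

The weak limits exist because box probabilities obey a recursion in the vacancy probability, and the
bounds pass to them because the events depend on finitely many vertices and are clopen. -/

/-! ### Weighted sums over independent sets and their factorisation at the root. -/

section GibbsSums

variable {d : ℕ}

/-- The configuration on the subtree rooted at the `i`-th child of the root. -/
def branch (σ : TreeVertex d → Bool) (i : Fin d) : TreeVertex d → Bool := fun u => σ (i :: u)

/-- The sum of `f` over the independent sets of the tree of height `L`, weighted by the activity. -/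
noncomputable def gibbsSum (d : ℕ) (lam : ℝ≥0) (L : ℕ) (f : (TreeVertex d → Bool) → ℝ) : ℝ :=
  ∑ I ∈ indepSets (dAryTree d) (treeBall d L), (lam : ℝ) ^ I.card * f (occupation I)

/-- The indicator of a vacant root. -/
noncomputable def rootVacant (σ : TreeVertex d → Bool) : ℝ := if σ [] = true then 0 else 1

theorem dAryTree_adj {u v : TreeVertex d} :
    (dAryTree d).Adj u v ↔ (∃ i : Fin d, v = u ++ [i]) ∨ ∃ i : Fin d, u = v ++ [i] := by
  simp only [dAryTree, SimpleGraph.fromRel_adj]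
  constructor
  · exact fun h => h.2
  · refine fun h => ⟨?_, h⟩
    rintro rfl
    rcases h with ⟨i, h⟩ | ⟨i, h⟩ <;> simpa using congrArg List.length h

theorem dAryTree_adj_cons {i j : Fin d} {u v : TreeVertex d} :
    (dAryTree d).Adj (i :: u) (j :: v) ↔ i = j ∧ (dAryTree d).Adj u v := by
  simp only [dAryTree_adj, List.cons_append, List.cons.injEq]
  constructor
  · rintro (⟨k, rfl, h⟩ | ⟨k, rfl, h⟩)
    · exact ⟨rfl, Or.inl ⟨k, h⟩⟩
    · exact ⟨rfl, Or.inr ⟨k, h⟩⟩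
  · rintro ⟨rfl, ⟨k, h⟩ | ⟨k, h⟩⟩
    · exact Or.inl ⟨k, rfl, h⟩
    · exact Or.inr ⟨k, rfl, h⟩

theorem dAryTree_adj_nil_cons {i : Fin d} {u : TreeVertex d} :
    (dAryTree d).Adj [] (i :: u) ↔ u = [] := by
  simp [dAryTree_adj]

theorem mem_treeBall {l : ℕ} {v : TreeVertex d} : v ∈ treeBall d l ↔ v.length ≤ l := by
  simp [treeBall]

theorem mem_indepSets {L : ℕ} {I : Finset (TreeVertex d)} :
    I ∈ indepSets (dAryTree d) (treeBall d L) ↔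
      (∀ v ∈ I, v.length ≤ L) ∧ ∀ u ∈ I, ∀ v ∈ I, ¬ (dAryTree d).Adj u v := by
  classical
  simp only [indepSets, Finset.mem_filter, Finset.mem_powerset, Finset.subset_iff, mem_treeBall,
    SimpleGraph.IsIndepSet, Set.Pairwise, Finset.mem_coe]
  refine and_congr_right fun _ => ⟨fun h u hu v hv huv => h hu hv huv.ne huv,
    fun h u hu v hv _ => h u hu v hv⟩

open Classical in
/-- The set of vertices with prescribed root state and prescribed branches. -/
noncomputable def graft (b : Bool) (p : Fin d → Finset (TreeVertex d)) : Finset (TreeVertex d) :=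
  (if b = true then {[]} else ∅) ∪
    Finset.univ.biUnion fun i => (p i).map ⟨List.cons i, List.cons_injective⟩

/-- The branch of a finite set of vertices at the `i`-th child of the root. -/
noncomputable def setBranch (I : Finset (TreeVertex d)) (i : Fin d) : Finset (TreeVertex d) :=
  I.preimage (List.cons i) List.cons_injective.injOn

@[simp] theorem nil_mem_graft {b : Bool} {p : Fin d → Finset (TreeVertex d)} :
    [] ∈ graft b p ↔ b = true := by
  cases b <;> simp [graft]

@[simp] theorem cons_mem_graft {b : Bool} {p : Fin d → Finset (TreeVertex d)} {i : Fin d}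
    {u : TreeVertex d} : i :: u ∈ graft b p ↔ u ∈ p i := by
  cases b <;> simp [graft]

@[simp] theorem mem_setBranch {I : Finset (TreeVertex d)} {i : Fin d} {u : TreeVertex d} :
    u ∈ setBranch I i ↔ i :: u ∈ I := by
  simp [setBranch]

theorem card_graft (b : Bool) (p : Fin d → Finset (TreeVertex d)) :
    (graft b p).card = (if b = true then 1 else 0) + ∑ i, (p i).card := by
  classical
  rw [graft, Finset.card_union_of_disjoint, Finset.card_biUnion]
  · cases b <;> simp
  · intro i _ j _ hij
    rw [Function.onFun, Finset.disjoint_left]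
    intro u hu hv
    simp only [Finset.mem_map, Function.Embedding.coeFn_mk] at hu hv
    obtain ⟨u, _, rfl⟩ := hu
    obtain ⟨v, _, h⟩ := hv
    exact hij (List.cons.inj h).1.symm
  · rw [Finset.disjoint_left]
    intro u hu hv
    cases b <;> simp_all

theorem graft_setBranch (I : Finset (TreeVertex d)) :
    graft (occupation I []) (setBranch I) = I := by
  ext v
  cases v <;> simp [occupation]

theorem setBranch_graft (b : Bool) (p : Fin d → Finset (TreeVertex d)) :
    setBranch (graft b p) = p := by
  ext i v; simp

theorem occupation_graft_nil (b : Bool) (p : Fin d → Finset (TreeVertex d)) :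
    occupation (graft b p) [] = b := by
  cases b <;> simp [occupation]

theorem branch_occupation (I : Finset (TreeVertex d)) (i : Fin d) :
    branch (occupation I) i = occupation (setBranch I i) := by
  ext u; simp [branch, occupation]

/-- An edge lies inside a branch or joins the root to a child, so the branches interact only through
the root. -/
theorem graft_mem_indepSets {L : ℕ} {b : Bool} {p : Fin d → Finset (TreeVertex d)} :
    graft b p ∈ indepSets (dAryTree d) (treeBall d (L + 1)) ↔
      ∀ i, p i ∈ indepSets (dAryTree d) (treeBall d L) ∧ (b = true → [] ∉ p i) := by
  simp only [mem_indepSets]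
  constructor
  · rintro ⟨h1, h2⟩ i
    refine ⟨⟨fun v hv => ?_, fun u hu v hv huv => ?_⟩, fun hb hi => ?_⟩
    · simpa using h1 (i :: v) (by simpa using hv)
    · exact h2 (i :: u) (by simpa using hu) (i :: v) (by simpa using hv)
        (dAryTree_adj_cons.2 ⟨rfl, huv⟩)
    · exact h2 [] (by simpa using hb) [i] (by simpa using hi) (dAryTree_adj_nil_cons.2 rfl)
  · intro h
    refine ⟨fun v hv => ?_, fun u hu v hv huv => ?_⟩
    · rcases v with _ | ⟨i, v⟩
      · simp
      · simpa using (h i).1.1 v (by simpa using hv)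
    · rcases u with _ | ⟨i, u⟩ <;> rcases v with _ | ⟨j, v⟩
      · exact huv.ne rfl
      · rw [dAryTree_adj_nil_cons] at huv
        subst huv
        exact (h j).2 (by simpa using hu) (by simpa using hv)
      · rw [SimpleGraph.adj_comm, dAryTree_adj_nil_cons] at huv
        subst huv
        exact (h i).2 (by simpa using hv) (by simpa using hu)
      · obtain ⟨rfl, huv'⟩ := dAryTree_adj_cons.1 huv
        exact (h i).1.2 u (by simpa using hu) v (by simpa using hv) huv'

theorem gibbsSum_congr {lam : ℝ≥0} {L : ℕ} {f g : (TreeVertex d → Bool) → ℝ}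
    (h : ∀ σ, f σ = g σ) : gibbsSum d lam L f = gibbsSum d lam L g := by
  rw [funext h]

theorem gibbsSum_add (lam : ℝ≥0) (L : ℕ) (f g : (TreeVertex d → Bool) → ℝ) :
    gibbsSum d lam L (fun σ => f σ + g σ) = gibbsSum d lam L f + gibbsSum d lam L g := by
  simp only [gibbsSum, mul_add, Finset.sum_add_distrib]

theorem gibbsSum_const_mul (lam : ℝ≥0) (L : ℕ) (c : ℝ) (f : (TreeVertex d → Bool) → ℝ) :
    gibbsSum d lam L (fun σ => c * f σ) = c * gibbsSum d lam L f := by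
  simp only [gibbsSum, Finset.mul_sum]
  exact Finset.sum_congr rfl fun _ _ => by ring

theorem gibbsSum_mono {lam : ℝ≥0} {L : ℕ} {f g : (TreeVertex d → Bool) → ℝ}
    (h : ∀ σ, f σ ≤ g σ) : gibbsSum d lam L f ≤ gibbsSum d lam L g :=
  Finset.sum_le_sum fun _ _ => mul_le_mul_of_nonneg_left (h _) (by positivity)

theorem gibbsSum_nonneg {lam : ℝ≥0} {L : ℕ} {f : (TreeVertex d → Bool) → ℝ}
    (h : ∀ σ, 0 ≤ f σ) : 0 ≤ gibbsSum d lam L f :=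
  Finset.sum_nonneg fun _ _ => mul_nonneg (by positivity) (h _)

theorem gibbsSum_zero (lam : ℝ≥0) (f : (TreeVertex d → Bool) → ℝ) :
    gibbsSum d lam 0 f = f (occupation ∅) + lam * f (occupation {[]}) := by
  classical
  have h : indepSets (dAryTree d) (treeBall d 0) = {∅, {[]}} := by
    ext I
    rw [mem_indepSets]
    simp only [nonpos_iff_eq_zero, List.length_eq_zero_iff, Finset.mem_insert,
      Finset.mem_singleton]
    rw [← Finset.subset_singleton_iff]
    constructor
    · exact fun h v hv => by simpa using h.1 v hv
    · refine fun h => ⟨fun v hv => by simpa using h hv, fun u hu v hv huv => huv.ne ?_⟩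
      have h1 := h hu
      have h2 := h hv
      simp only [Finset.mem_singleton] at h1 h2
      rw [h1, h2]
  rw [gibbsSum, h, Finset.sum_pair (by simp)]
  simp

/-- The weighted sum of a product over the branches at the root factorises. -/
theorem gibbsSum_succ_prod (lam : ℝ≥0) (L : ℕ) (g : Bool → ℝ)
    (f : Fin d → (TreeVertex d → Bool) → ℝ) :
    gibbsSum d lam (L + 1) (fun σ => g (σ []) * ∏ i, f i (branch σ i)) =
      g false * ∏ i, gibbsSum d lam L (f i) +
        g true * lam * ∏ i, gibbsSum d lam L (fun τ => rootVacant τ * f i τ) := by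
  classical
  -- For a fixed root state, `setBranch` and `graft` are inverse bijections between independent sets
  -- and families of independent sets of the branches.
  have key : ∀ b : Bool, ∑ I ∈ (indepSets (dAryTree d) (treeBall d (L + 1))).filter
        (fun I => occupation I [] = b),
        (lam : ℝ) ^ I.card * (g (occupation I []) * ∏ i, f i (branch (occupation I) i)) =
      ∑ p ∈ Fintype.piFinset fun _ : Fin d =>
        (indepSets (dAryTree d) (treeBall d L)).filter (fun J => b = true → [] ∉ J),
        g b * lam ^ (if b = true then 1 else 0) *
          ∏ i, (lam : ℝ) ^ (p i).card * f i (occupation (p i)) := by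
    intro b
    refine Finset.sum_nbij' setBranch (graft b) ?_ ?_ ?_ ?_ ?_
    · intro I hI
      rw [Finset.mem_filter] at hI
      have h := hI.1
      rw [← graft_setBranch I, hI.2, graft_mem_indepSets] at h
      simpa [Fintype.mem_piFinset, Finset.mem_filter] using h
    · intro p hp
      simp only [Fintype.mem_piFinset, Finset.mem_filter] at hp
      exact Finset.mem_filter.2 ⟨graft_mem_indepSets.2 hp, occupation_graft_nil b p⟩
    · intro I hI
      rw [← (Finset.mem_filter.1 hI).2, graft_setBranch]
    · exact fun p _ => setBranch_graft b p
    · intro I hI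
      have hb := (Finset.mem_filter.1 hI).2
      have hc : I.card = (if b = true then 1 else 0) + ∑ i, (setBranch I i).card := by
        rw [← card_graft, ← hb, graft_setBranch]
      rw [hc, hb, Finset.prod_mul_distrib, Finset.prod_pow_eq_pow_sum, pow_add]
      simp only [branch_occupation]
      ring
  have hsplit : ∀ h : Finset (TreeVertex d) → ℝ,
      ∑ I ∈ indepSets (dAryTree d) (treeBall d (L + 1)), h I =
        ∑ I ∈ (indepSets (dAryTree d) (treeBall d (L + 1))).filter
          (fun I => occupation I [] = false), h I +
        ∑ I ∈ (indepSets (dAryTree d) (treeBall d (L + 1))).filter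
          (fun I => occupation I [] = true), h I := by
    intro h
    rw [← Finset.sum_filter_add_sum_filter_not _ (fun I => occupation I [] = true), add_comm]
    simp
  have hprod : ∀ (t : Finset (Finset (TreeVertex d))) (e : Fin d → Finset (TreeVertex d) → ℝ),
      ∑ p ∈ Fintype.piFinset (fun _ : Fin d => t), ∏ i, e i (p i) = ∏ i, ∑ J ∈ t, e i J := by
    intro t e
    rw [Finset.prod_univ_sum]
  rw [gibbsSum, hsplit, key false, key true, ← Finset.mul_sum, ← Finset.mul_sum,
    hprod _ fun i J => (lam : ℝ) ^ J.card * f i (occupation J),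
    hprod _ fun i J => (lam : ℝ) ^ J.card * f i (occupation J)]
  have hvac : ∀ i, gibbsSum d lam L (fun τ => rootVacant τ * f i τ) =
      ∑ J ∈ (indepSets (dAryTree d) (treeBall d L)).filter (fun J => true = true → [] ∉ J),
        (lam : ℝ) ^ J.card * f i (occupation J) := by
    intro i
    rw [Finset.sum_filter, gibbsSum]
    refine Finset.sum_congr rfl fun J _ => ?_
    by_cases h : [] ∈ J <;> simp [rootVacant, occupation, h]
  simp only [hvac]
  simp [gibbsSum]

end GibbsSums

/-! ### Means under the hard-core measure and the conditional vacancy probability. -/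

section TreeMean

variable {d : ℕ}

/-- The mean of `f` under the hard-core measure on the tree of height `L`. -/
noncomputable def treeMean (d : ℕ) (lam : ℝ≥0) (L : ℕ) (f : (TreeVertex d → Bool) → ℝ) : ℝ :=
  gibbsSum d lam L f / gibbsSum d lam L fun _ => 1

/-- The probability that the root of the tree of height `L` is vacant. -/
noncomputable def vacProb (d : ℕ) (lam : ℝ≥0) (L : ℕ) : ℝ := treeMean d lam L rootVacant

theorem gibbsSum_one_eq (lam : ℝ≥0) (L : ℕ) :
    gibbsSum d lam L (fun _ => 1) = hardCoreZ (dAryTree d) lam (treeBall d L) := by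
  simp [gibbsSum, hardCoreZ]

theorem gibbsSum_one_pos (lam : ℝ≥0) (L : ℕ) : 0 < gibbsSum d lam L fun _ => 1 := by
  rw [gibbsSum_one_eq]
  exact_mod_cast hardCoreZ_pos _ _ _

theorem treeMean_congr {lam : ℝ≥0} {L : ℕ} {f g : (TreeVertex d → Bool) → ℝ}
    (h : ∀ σ, f σ = g σ) : treeMean d lam L f = treeMean d lam L g := by
  rw [funext h]

theorem treeMean_one (lam : ℝ≥0) (L : ℕ) : treeMean d lam L (fun _ => 1) = 1 :=
  div_self (gibbsSum_one_pos lam L).ne'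

theorem treeMean_const (lam : ℝ≥0) (L : ℕ) (c : ℝ) : treeMean d lam L (fun _ => c) = c := by
  have := gibbsSum_const_mul (d := d) lam L c (fun _ => 1)
  simp only [mul_one] at this
  rw [treeMean, this, mul_div_assoc, div_self (gibbsSum_one_pos lam L).ne', mul_one]

theorem treeMean_add (lam : ℝ≥0) (L : ℕ) (f g : (TreeVertex d → Bool) → ℝ) :
    treeMean d lam L (fun σ => f σ + g σ) = treeMean d lam L f + treeMean d lam L g := by
  rw [treeMean, gibbsSum_add, add_div, treeMean, treeMean]

theorem treeMean_const_mul (lam : ℝ≥0) (L : ℕ) (c : ℝ) (f : (TreeVertex d → Bool) → ℝ) :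
    treeMean d lam L (fun σ => c * f σ) = c * treeMean d lam L f := by
  rw [treeMean, gibbsSum_const_mul, mul_div_assoc, treeMean]

theorem treeMean_mono {lam : ℝ≥0} {L : ℕ} {f g : (TreeVertex d → Bool) → ℝ}
    (h : ∀ σ, f σ ≤ g σ) : treeMean d lam L f ≤ treeMean d lam L g :=
  div_le_div_of_nonneg_right (gibbsSum_mono h) (gibbsSum_one_pos lam L).le

theorem rootVacant_nonneg (σ : TreeVertex d → Bool) : 0 ≤ rootVacant σ := by
  unfold rootVacant; split_ifs <;> norm_num

theorem rootVacant_le_one (σ : TreeVertex d → Bool) : rootVacant σ ≤ 1 := by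
  unfold rootVacant; split_ifs <;> norm_num

theorem gibbsSum_succ_prod_branch (lam : ℝ≥0) (L : ℕ) (f : Fin d → (TreeVertex d → Bool) → ℝ) :
    gibbsSum d lam (L + 1) (fun σ => ∏ i, f i (branch σ i)) =
      ∏ i, gibbsSum d lam L (f i) +
        lam * ∏ i, gibbsSum d lam L (fun τ => rootVacant τ * f i τ) := by
  simpa using gibbsSum_succ_prod lam L (fun _ => 1) f

theorem gibbsSum_succ_rootVacant_mul_prod (lam : ℝ≥0) (L : ℕ)
    (f : Fin d → (TreeVertex d → Bool) → ℝ) :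
    gibbsSum d lam (L + 1) (fun σ => rootVacant σ * ∏ i, f i (branch σ i)) =
      ∏ i, gibbsSum d lam L (f i) := by
  simpa [rootVacant] using gibbsSum_succ_prod lam L (fun b => if b = true then 0 else 1) f

theorem gibbsSum_succ_one (lam : ℝ≥0) (L : ℕ) :
    gibbsSum d lam (L + 1) (fun _ => 1) =
      gibbsSum d lam L (fun _ => 1) ^ d + lam * gibbsSum d lam L rootVacant ^ d := by
  simpa using gibbsSum_succ_prod_branch (d := d) lam L fun _ _ => 1

theorem gibbsSum_succ_rootVacant (lam : ℝ≥0) (L : ℕ) :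
    gibbsSum d lam (L + 1) rootVacant = gibbsSum d lam L (fun _ => 1) ^ d := by
  simpa using gibbsSum_succ_rootVacant_mul_prod (d := d) lam L fun _ _ => 1

theorem vacProb_zero (lam : ℝ≥0) : vacProb d lam 0 = 1 / (1 + lam) := by
  simp [vacProb, treeMean, gibbsSum_zero, rootVacant, occupation]

theorem vacProb_succ (lam : ℝ≥0) (L : ℕ) :
    vacProb d lam (L + 1) = 1 / (1 + lam * vacProb d lam L ^ d) := by
  have h := gibbsSum_one_pos (d := d) lam L
  rw [vacProb, vacProb, treeMean, treeMean, gibbsSum_succ_one, gibbsSum_succ_rootVacant, div_pow]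
  have h0 := gibbsSum_nonneg (lam := lam) (L := L) (rootVacant_nonneg (d := d))
  have : 0 < gibbsSum d lam L (fun _ => 1) ^ d := by positivity
  have : 0 ≤ (lam : ℝ) * gibbsSum d lam L rootVacant ^ d := by positivity
  field_simp

/-- The law of the branches is dominated by `1 + lam` times the product measure. -/
theorem treeMean_succ_prod_branch_le (lam : ℝ≥0) (L : ℕ)
    {f : Fin d → (TreeVertex d → Bool) → ℝ} (hf : ∀ i σ, 0 ≤ f i σ) :
    treeMean d lam (L + 1) (fun σ => ∏ i, f i (branch σ i)) ≤
      (1 + lam) * ∏ i, treeMean d lam L (f i) := by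
  have hZ := gibbsSum_one_pos (d := d) lam L
  have h0 : 0 ≤ ∏ i, gibbsSum d lam L (f i) := Finset.prod_nonneg fun i _ => gibbsSum_nonneg (hf i)
  have h1 : ∏ i, gibbsSum d lam L (fun τ => rootVacant τ * f i τ) ≤
      ∏ i, gibbsSum d lam L (f i) := by
    refine Finset.prod_le_prod (fun i _ => gibbsSum_nonneg fun τ =>
      mul_nonneg (rootVacant_nonneg τ) (hf i τ)) fun i _ => gibbsSum_mono fun τ => ?_
    exact mul_le_of_le_one_left (hf i τ) (rootVacant_le_one τ)
  -- The configurations with vacant root alone already have the weight of the product measure.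
  have h2 : gibbsSum d lam L (fun _ => 1) ^ d ≤ gibbsSum d lam (L + 1) (fun _ => 1) := by
    rw [gibbsSum_succ_one]
    have := gibbsSum_nonneg (lam := lam) (L := L) (rootVacant_nonneg (d := d))
    have : 0 ≤ (lam : ℝ) * gibbsSum d lam L rootVacant ^ d := by positivity
    linarith
  simp only [treeMean]
  rw [gibbsSum_succ_prod_branch, Finset.prod_div_distrib, Finset.prod_const, Finset.card_univ,
    Fintype.card_fin, ← mul_div_assoc]
  have h3 := mul_le_mul_of_nonneg_left h1 lam.coe_nonneg
  exact div_le_div₀ (by positivity) (by linarith) (by positivity) h2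

theorem treeMean_succ_branch_le (lam : ℝ≥0) (L : ℕ) {f : (TreeVertex d → Bool) → ℝ}
    (hf : ∀ σ, 0 ≤ f σ) (i : Fin d) :
    treeMean d lam (L + 1) (fun σ => f (branch σ i)) ≤ (1 + lam) * treeMean d lam L f := by
  have h := treeMean_succ_prod_branch_le lam L (f := fun j => if j = i then f else fun _ => 1)
    (fun j σ => by split_ifs; exacts [hf σ, zero_le_one])
  have h1 : ∏ j, treeMean d lam L (if j = i then f else fun _ => 1) = treeMean d lam L f := by
    rw [Finset.prod_eq_single i]
    · simp
    · intro j _ hj; simp [hj, treeMean_one]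
    · simp
  rw [h1] at h
  refine le_trans (le_of_eq (treeMean_congr fun σ => ?_)) h
  rw [Finset.prod_eq_single i]
  · simp
  · intro j _ hj; simp [hj]
  · simp

/-- Near-independence of two branches: this is the source of the squaring of bad probabilities. -/
theorem treeMean_succ_branch_mul_branch_le (lam : ℝ≥0) (L : ℕ) {f : (TreeVertex d → Bool) → ℝ}
    (hf : ∀ σ, 0 ≤ f σ) {i j : Fin d} (hij : i ≠ j) :
    treeMean d lam (L + 1) (fun σ => f (branch σ i) * f (branch σ j)) ≤
      (1 + lam) * treeMean d lam L f ^ 2 := by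
  have h := treeMean_succ_prod_branch_le lam L
    (f := fun k => if k = i ∨ k = j then f else fun _ => 1)
    (fun j σ => by split_ifs; exacts [hf σ, zero_le_one])
  have h1 : ∀ g : Fin d → ℝ, (∀ k, k ≠ i → k ≠ j → g k = 1) → ∏ k, g k = g i * g j := by
    intro g hg
    rw [← Finset.prod_pair hij]
    refine (Finset.prod_subset (Finset.subset_univ _) fun k _ hk => ?_).symm
    simp only [Finset.mem_insert, Finset.mem_singleton, not_or] at hk
    exact hg k hk.1 hk.2
  rw [h1 _ fun k hi hj => by simp [hi, hj, treeMean_one]] at h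
  simp only [true_or, or_true, if_true, ← pow_two] at h
  refine le_trans (le_of_eq (treeMean_congr fun σ => ?_)) h
  rw [h1 _ fun k hi hj => by simp [hi, hj]]
  simp

/-- The probability that the root is vacant on the tree of height `l`, given the configuration
at level `l`. -/
noncomputable def condVac (d : ℕ) (lam : ℝ≥0) : ℕ → (TreeVertex d → Bool) → ℝ
  | 0, σ => rootVacant σ
  | l + 1, σ => 1 / (1 + lam * ∏ i, condVac d lam l (branch σ i))

open Classical in
/-- The indicator of agreement with `s` at level `l`. -/
noncomputable def agree (l : ℕ) (s σ : TreeVertex d → Bool) : ℝ :=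
  if ∀ v : TreeVertex d, v.length = l → σ v = s v then 1 else 0

theorem agree_zero (s σ : TreeVertex d → Bool) : agree 0 s σ = if σ [] = s [] then 1 else 0 := by
  simp [agree]

theorem agree_succ (l : ℕ) (s σ : TreeVertex d → Bool) :
    agree (l + 1) s σ = ∏ i, agree l (branch s i) (branch σ i) := by
  have h : (∀ v : TreeVertex d, v.length = l + 1 → σ v = s v) ↔
      ∀ i, ∀ v : TreeVertex d, v.length = l → branch σ i v = branch s i v := by
    constructor
    · exact fun h i v hv => h (i :: v) (by simp [hv])
    · rintro h (_ | ⟨i, v⟩) hv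
      · simp at hv
      · exact h i v (by simpa using hv)
  simp only [agree, Finset.prod_ite_zero, Finset.prod_const_one]
  by_cases hv : ∀ v : TreeVertex d, v.length = l + 1 → σ v = s v
  · rw [if_pos hv, if_pos fun i _ => h.1 hv i]
  · rw [if_neg hv, if_neg fun hb => hv (h.2 fun i => hb i (Finset.mem_univ i))]

theorem condVac_nonneg (lam : ℝ≥0) (l : ℕ) (σ : TreeVertex d → Bool) : 0 ≤ condVac d lam l σ := by
  induction l generalizing σ with
  | zero => exact rootVacant_nonneg σ
  | succ l ih =>
    have := Finset.prod_nonneg fun i (_ : i ∈ Finset.univ) => ih (branch σ i)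
    rw [condVac]
    positivity

theorem condVac_congr (lam : ℝ≥0) {l : ℕ} {σ τ : TreeVertex d → Bool}
    (h : ∀ v : TreeVertex d, v.length = l → σ v = τ v) : condVac d lam l σ = condVac d lam l τ := by
  induction l generalizing σ τ with
  | zero => simp [condVac, rootVacant, h [] rfl]
  | succ l ih =>
    simp only [condVac]
    rw [Finset.prod_congr rfl fun i _ => ih (σ := branch σ i) (τ := branch τ i)
      fun v hv => h (i :: v) (by simp [hv])]

/-- Conditionally on level `l` of a deeper tree, the root is vacant with probability `condVac`. -/
theorem gibbsSum_rootVacant_mul_agree (lam : ℝ≥0) {l L : ℕ} (h : l ≤ L)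
    (s : TreeVertex d → Bool) :
    gibbsSum d lam L (fun σ => rootVacant σ * agree l s σ) =
      condVac d lam l s * gibbsSum d lam L (agree l s) := by
  induction l generalizing L s with
  | zero =>
    rw [← gibbsSum_const_mul]
    refine gibbsSum_congr fun σ => ?_
    rw [agree_zero]
    by_cases hs : σ [] = s [] <;> simp [condVac, rootVacant, hs]
  | succ l ih =>
    obtain ⟨L, rfl⟩ := Nat.exists_eq_add_one_of_ne_zero (by omega : L ≠ 0)
    rw [gibbsSum_congr fun σ => by rw [agree_succ], gibbsSum_succ_rootVacant_mul_prod,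
      gibbsSum_congr (agree_succ l s), gibbsSum_succ_prod_branch]
    simp only [ih (by omega : l ≤ L), Finset.prod_mul_distrib, condVac]
    have := Finset.prod_nonneg fun i (_ : i ∈ Finset.univ) => condVac_nonneg lam l (branch s i)
    have : 0 ≤ (lam : ℝ) * ∏ i, condVac d lam l (branch s i) := by positivity
    field_simp

/-- The tower property: split the sum according to the trace of the independent set on level `l`, on
which `condVac` is constant. -/
theorem treeMean_condVac (lam : ℝ≥0) {l L : ℕ} (h : l ≤ L) :
    treeMean d lam L (condVac d lam l) = vacProb d lam L := by
  classical
  rw [vacProb, treeMean, treeMean]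
  congr 1
  let r : Finset (TreeVertex d) → Finset (TreeVertex d) := fun I => I.filter fun v => v.length = l
  set S := indepSets (dAryTree d) (treeBall d L)
  have hagree : ∀ I J : Finset (TreeVertex d), J ∈ S.image r →
      agree l (occupation J) (occupation I) = if r I = J then 1 else 0 := by
    intro I J hJ
    obtain ⟨K, _, rfl⟩ := Finset.mem_image.1 hJ
    rw [agree]
    refine if_congr ?_ rfl rfl
    simp only [Finset.ext_iff, r, occupation, Finset.mem_filter, decide_eq_decide]
    exact ⟨fun h v => and_congr_left_iff.2 fun hv => by simpa [hv] using h v hv,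
      fun h v hv => by simpa [hv] using h v⟩
  have hsplit : ∀ f : (TreeVertex d → Bool) → ℝ, gibbsSum d lam L f =
      ∑ J ∈ S.image r, gibbsSum d lam L (fun σ => f σ * agree l (occupation J) σ) := by
    intro f
    simp only [gibbsSum]
    rw [Finset.sum_comm]
    refine Finset.sum_congr rfl fun I hI => ?_
    rw [Finset.sum_eq_single_of_mem (r I) (Finset.mem_image_of_mem r hI)]
    · rw [hagree I (r I) (Finset.mem_image_of_mem r hI)]; simp
    · intro J hJ hne
      rw [hagree I J hJ, if_neg hne.symm]; simp
  rw [hsplit, hsplit rootVacant]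
  refine Finset.sum_congr rfl fun J _ => ?_
  rw [gibbsSum_rootVacant_mul_agree lam h, ← gibbsSum_const_mul]
  refine gibbsSum_congr fun σ => ?_
  by_cases hσ : ∀ v : TreeVertex d, v.length = l → σ v = occupation J v
  · rw [condVac_congr lam hσ]
  · simp [agree, hσ]

/-- The leaves form an independent set, so every boundary configuration is realised; the
conditioning is never on a null event. -/
theorem gibbsSum_agree_pos {lam : ℝ≥0} (hlam : 0 < lam) (l : ℕ) (s : TreeVertex d → Bool) :
    0 < gibbsSum d lam l (agree l s) := by
  induction l generalizing s with
  | zero =>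
    rw [gibbsSum_zero, agree_zero, agree_zero]
    cases h : s [] <;> simp [occupation, hlam]
  | succ l ih =>
    rw [gibbsSum_congr (agree_succ l s), gibbsSum_succ_prod_branch]
    have h1 := Finset.prod_pos fun i (_ : i ∈ Finset.univ) => ih (branch s i)
    have h2 : 0 ≤ ∏ i, gibbsSum d lam l (fun τ => rootVacant τ * agree l (branch s i) τ) :=
      Finset.prod_nonneg fun i _ => gibbsSum_nonneg fun τ => mul_nonneg (rootVacant_nonneg τ)
        (by unfold agree; split_ifs <;> norm_num)
    positivity

theorem treeGibbs_real (lam : ℝ≥0) (L : ℕ) (A : Set (TreeVertex d → Bool)) :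
    (treeGibbs d lam L : Measure (TreeVertex d → Bool)).real A =
      treeMean d lam L (A.indicator 1) := by
  have hZ := hardCoreZ_pos (dAryTree d) lam (treeBall d L)
  rw [treeMean, gibbsSum_one_eq, gibbsSum, Finset.sum_div]
  simp only [treeGibbs, ProbabilityMeasure.coe_mk, hardCoreMeasure, Measure.real,
    Measure.coe_finsetSum, Finset.sum_apply, Measure.smul_apply, smul_eq_mul, Measure.dirac_apply]
  rw [ENNReal.toReal_sum]
  · refine Finset.sum_congr rfl fun I _ => ?_
    by_cases h : occupation I ∈ A <;> simp [h]
  · intro I _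
    by_cases h : occupation I ∈ A <;> simp [h]

theorem rootMarginal_eq (lam : ℝ≥0) (L : ℕ) : rootMarginal d lam L = 1 - vacProb d lam L := by
  have h := treeMean_add (d := d) lam L ({τ | τ [] = true}.indicator 1) rootVacant
  rw [treeMean_congr (g := fun _ => 1), treeMean_one] at h
  · rw [rootMarginal, treeGibbs_real, vacProb]
    linarith
  · intro σ
    by_cases hσ : σ [] = true <;> simp [rootVacant, hσ]

/-- The conditioning here is in the tree of height exactly `l`; `gibbsSum_rootVacant_mul_agree`
gives the same function `condVac` in every taller tree, which lets tail bounds be proved there. -/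
theorem condRootMarginal_eq {lam : ℝ≥0} (hlam : 0 < lam) (l : ℕ) (σ : TreeVertex d → Bool) :
    condRootMarginal d lam l σ = 1 - condVac d lam l σ := by
  set A : Set (TreeVertex d → Bool) := {τ | ∀ v : TreeVertex d, v.length = l → τ v = σ v} with hA
  have hmeas : MeasurableSet A := by
    have : A = ⋂ v : TreeVertex d, ⋂ _ : v.length = l, (fun τ => τ v) ⁻¹' {σ v} := by
      ext τ; simp [hA]
    rw [this]
    exact MeasurableSet.iInter fun v => MeasurableSet.iInter fun _ =>
      measurable_pi_apply v (MeasurableSet.singleton _)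
  have hZ := gibbsSum_one_pos (d := d) lam l
  have hpos := gibbsSum_agree_pos hlam l σ
  have hag : ∀ τ, agree l σ τ = A.indicator 1 τ := by
    intro τ
    by_cases h : ∀ v : TreeVertex d, v.length = l → τ v = σ v
    · rw [Set.indicator_of_mem (show τ ∈ A from h), agree, if_pos h]; rfl
    · rw [Set.indicator_of_notMem (show τ ∉ A from h), agree, if_neg h]
  have h1 : treeMean d lam l (A.indicator 1) = treeMean d lam l (agree l σ) :=
    treeMean_congr fun τ => (hag τ).symm
  have h2 : treeMean d lam l ((A ∩ {τ | τ [] = true}).indicator 1) =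
      (1 - condVac d lam l σ) * treeMean d lam l (agree l σ) := by
    have h := treeMean_add lam l ((A ∩ {τ | τ [] = true}).indicator 1)
      (fun τ => rootVacant τ * agree l σ τ)
    rw [treeMean_congr (g := agree l σ)] at h
    · have h3 : treeMean d lam l (fun τ => rootVacant τ * agree l σ τ) =
          condVac d lam l σ * treeMean d lam l (agree l σ) := by
        rw [treeMean, gibbsSum_rootVacant_mul_agree lam le_rfl, mul_div_assoc, treeMean]
      linarith
    · intro τ
      rw [hag]
      by_cases h : τ ∈ A <;> by_cases hr : τ [] = true <;> simp [h, hr, rootVacant]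
  rw [condRootMarginal, Measure.real, ProbabilityTheory.cond_apply hmeas, ENNReal.toReal_mul,
    ENNReal.toReal_inv]
  change ((treeGibbs d lam l : Measure (TreeVertex d → Bool)).real A)⁻¹ *
    (treeGibbs d lam l : Measure (TreeVertex d → Bool)).real (A ∩ {τ | τ [] = true}) = _
  rw [treeGibbs_real, treeGibbs_real, h1, h2]
  have : treeMean d lam l (agree l σ) ≠ 0 := (div_pos hpos hZ).ne'
  field_simp

end TreeMean

/-! ### The one-dimensional recursion and its attracting two-cycle. -/

section Cycle

/-- The recursion for the probability of a vacant root. -/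
noncomputable def vacMap (d : ℕ) (lam : ℝ≥0) (u : ℝ) : ℝ := 1 / (1 + lam * u ^ d)

/-- The extreme values of the probability of a vacant root given the configuration at level `l`. -/
noncomputable def vacBounds (d : ℕ) (lam : ℝ≥0) : ℕ → ℝ × ℝ
  | 0 => (0, 1)
  | l + 1 => (vacMap d lam (vacBounds d lam l).2, vacMap d lam (vacBounds d lam l).1)

variable {d : ℕ} {lam : ℝ≥0}

theorem vacMap_anti {u v : ℝ} (hu : 0 ≤ u) (huv : u ≤ v) : vacMap d lam v ≤ vacMap d lam u := by
  have : u ^ d ≤ v ^ d := pow_le_pow_left₀ hu huv d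
  have : (lam : ℝ) * u ^ d ≤ lam * v ^ d := mul_le_mul_of_nonneg_left this lam.coe_nonneg
  exact one_div_le_one_div_of_le (by positivity) (by linarith)

theorem vacMap_strictAnti (hd : d ≠ 0) (hlam : 0 < lam) {u v : ℝ} (hu : 0 ≤ u) (huv : u < v) :
    vacMap d lam v < vacMap d lam u := by
  have : u ^ d < v ^ d := pow_lt_pow_left₀ huv hu hd
  have : (lam : ℝ) * u ^ d < lam * v ^ d := mul_lt_mul_of_pos_left this (by exact_mod_cast hlam)
  exact one_div_lt_one_div_of_lt (by positivity) (by linarith)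

theorem vacMap_pos {u : ℝ} (hu : 0 ≤ u) : 0 < vacMap d lam u := by
  unfold vacMap; positivity

theorem vacMap_le_one {u : ℝ} (hu : 0 ≤ u) : vacMap d lam u ≤ 1 := by
  unfold vacMap
  rw [div_le_one (by positivity)]
  have : 0 ≤ (lam : ℝ) * u ^ d := by positivity
  linarith

theorem vacMap_zero (hd : d ≠ 0) : vacMap d lam 0 = 1 := by simp [vacMap, hd]

theorem vacBounds_fst_nonneg (l : ℕ) : 0 ≤ (vacBounds d lam l).1 ∧ 0 ≤ (vacBounds d lam l).2 := by
  induction l with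
  | zero => simp [vacBounds]
  | succ l ih => exact ⟨(vacMap_pos ih.2).le, (vacMap_pos ih.1).le⟩

theorem vacBounds_step (hd : d ≠ 0) (l : ℕ) :
    (vacBounds d lam l).1 ≤ (vacBounds d lam (l + 1)).1 ∧
      (vacBounds d lam (l + 1)).2 ≤ (vacBounds d lam l).2 := by
  induction l with
  | zero => exact ⟨(vacMap_pos zero_le_one).le, (vacMap_zero hd).le⟩
  | succ l ih =>
    exact ⟨vacMap_anti (vacBounds_fst_nonneg _).2 ih.2, vacMap_anti (vacBounds_fst_nonneg _).1 ih.1⟩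

theorem vacBounds_le (l : ℕ) : (vacBounds d lam l).1 ≤ (vacBounds d lam l).2 := by
  induction l with
  | zero => simp [vacBounds]
  | succ l ih => exact vacMap_anti (vacBounds_fst_nonneg _).1 ih

theorem vacBounds_snd_le_one (l : ℕ) : (vacBounds d lam l).2 ≤ 1 := by
  cases l with
  | zero => simp [vacBounds]
  | succ l => exact vacMap_le_one (vacBounds_fst_nonneg l).1

theorem continuousAt_vacMap {u : ℝ} (hu : 0 ≤ u) : ContinuousAt (vacMap d lam) u := by
  have : (1 + lam * u ^ d : ℝ) ≠ 0 := by positivity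
  unfold vacMap
  fun_prop (disch := assumption)

theorem hasDerivAt_vacMap {u : ℝ} (hu : 0 ≤ u) :
    HasDerivAt (vacMap d lam) (-(lam * (d * u ^ (d - 1))) * vacMap d lam u ^ 2) u := by
  have h0 : (1 + lam * u ^ d : ℝ) ≠ 0 := by positivity
  have h := (((hasDerivAt_pow d u).const_mul (lam : ℝ)).const_add 1).inv h0
  have he : vacMap d lam = (fun x : ℝ => 1 + (lam : ℝ) * x ^ d)⁻¹ := by
    ext x; simp [vacMap]
  rw [he]
  refine h.congr_deriv ?_
  simp only [Pi.inv_apply]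
  field_simp

/-- The derivative of the recursion at a fixed point. -/
theorem hasDerivAt_vacMap_fixed (hd : d ≠ 0) {u : ℝ} (hu : 0 < u) (hf : vacMap d lam u = u) :
    HasDerivAt (vacMap d lam) (-(d * (1 - u))) u := by
  refine (hasDerivAt_vacMap hu.le).congr_deriv ?_
  rw [hf]
  have h1 : (0 : ℝ) < 1 + lam * u ^ d := by positivity
  rw [vacMap, div_eq_iff h1.ne'] at hf
  obtain ⟨e, rfl⟩ := Nat.exists_eq_add_one_of_ne_zero hd
  simp only [Nat.add_sub_cancel]
  linear_combination ((e + 1 : ℕ) : ℝ) * hf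

/-- Above the critical activity a fixed point of the recursion is repelling. -/
theorem one_lt_of_fixed (hd : 2 ≤ d) (hlam : (d : ℝ) ^ d / ((d : ℝ) - 1) ^ (d + 1) < lam) {u : ℝ}
    (hu : 0 < u) (hf : vacMap d lam u = u) : 1 < d * (1 - u) := by
  by_contra! h
  have hd' : (2 : ℝ) ≤ d := by exact_mod_cast hd
  have h1 : (0 : ℝ) < 1 + lam * u ^ d := by positivity
  rw [vacMap, div_eq_iff h1.ne'] at hf
  -- With the fixed-point equation `lam * u ^ (d + 1) = 1 - u`, this bound forces `lam` to be at
  -- most the critical value.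
  have hx : ((d : ℝ) - 1) ≤ d * u := by linarith
  have h2 : ((d : ℝ) - 1) ^ (d + 1) ≤ (d * u) ^ (d + 1) :=
    pow_le_pow_left₀ (by linarith) hx _
  rw [div_lt_iff₀ (pow_pos (by linarith) _)] at hlam
  have h3 : (lam : ℝ) * u ^ (d + 1) = 1 - u := by rw [pow_succ]; linarith
  have h4 : (lam : ℝ) * ((d : ℝ) - 1) ^ (d + 1) ≤ d ^ d * (d * (1 - u)) := by
    calc (lam : ℝ) * ((d : ℝ) - 1) ^ (d + 1) ≤ lam * (d * u) ^ (d + 1) := by gcongr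
      _ = d ^ (d + 1) * (lam * u ^ (d + 1)) := by rw [mul_pow]; ring
      _ = d ^ d * (d * (1 - u)) := by rw [h3]; ring
  have h5 : (d : ℝ) ^ d * (d * (1 - u)) ≤ d ^ d * 1 := by gcongr
  linarith

/-- The logarithmic mean is at least the geometric mean. -/
theorem sqrt_mul_log_le {x y : ℝ} (hy : 0 < y) (hyx : y ≤ x) :
    √(x * y) * (Real.log x - Real.log y) ≤ x - y := by
  have hx : 0 < x := hy.trans_le hyx
  -- Since `exp s = √x / √y`, the claim is `s ≤ sinh s` multiplied by `2 * √x * √y`.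
  set s := (Real.log x - Real.log y) / 2 with hs
  have hs0 : 0 ≤ s := by
    have := Real.log_le_log hy hyx
    rw [hs]; linarith
  have h := Real.self_le_sinh_iff.2 hs0
  have hex : Real.exp s = √x / √y := by
    rw [hs, sub_div, Real.exp_sub, ← Real.log_sqrt hx.le, ← Real.log_sqrt hy.le,
      Real.exp_log (Real.sqrt_pos.2 hx), Real.exp_log (Real.sqrt_pos.2 hy)]
  have hsx := Real.sqrt_pos.2 hx
  have hsy := Real.sqrt_pos.2 hy
  rw [Real.sinh_eq, Real.exp_neg, hex] at h
  have h2 : √x * √y * ((√x / √y - (√x / √y)⁻¹) / 2) = (x - y) / 2 := by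
    field_simp
    rw [Real.sq_sqrt hx.le, Real.sq_sqrt hy.le]
  have h3 := mul_le_mul_of_nonneg_left h (mul_pos hsx hsy).le
  rw [h2] at h3
  rw [Real.sqrt_mul hx.le]
  have h4 : Real.log x - Real.log y = 2 * s := by rw [hs]; ring
  rw [h4]
  linarith

/-- The logarithmic mean is at most the arithmetic mean. -/
theorem le_log_sub_log {a b : ℝ} (ha : 0 < a) (hab : a ≤ b) :
    2 * (b - a) ≤ (a + b) * (Real.log b - Real.log a) := by
  have h := Real.le_log_one_add_of_nonneg (x := b / a - 1) (by
    rw [sub_nonneg, one_le_div ha]; exact hab)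
  rw [add_sub_cancel, Real.log_div (ha.trans_le hab).ne' ha.ne'] at h
  have h1 : 2 * (b / a - 1) / (b / a - 1 + 2) = 2 * (b - a) / (a + b) := by
    have : 0 < b := ha.trans_le hab
    have h3 : b / a - 1 + 2 = (a + b) / a := by field_simp; ring
    rw [h3]
    field_simp
  rw [h1, div_le_iff₀ (by linarith)] at h
  linarith

/-- A two-cycle of the recursion is attracting. -/
theorem cycle_attracting (hd : 2 ≤ d) {α β : ℝ} (hα : 0 < α) (hαβ : α < β) (hβ : β < 1)
    (h1 : vacMap d lam α = β) (h2 : vacMap d lam β = α) :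
    d * √((1 - α) * (1 - β)) < 1 := by
  have hβ0 : 0 < β := hα.trans hαβ
  have hd' : (2 : ℝ) ≤ d := by exact_mod_cast hd
  rw [vacMap, div_eq_iff (by positivity)] at h1 h2
  set g := √((1 - α) * (1 - β)) with hg
  have hlam : (lam : ℝ) ≠ 0 := by
    intro h
    rw [h] at h1
    linarith
  -- The cycle equations read `1 - α = lam * α * β ^ d` and `1 - β = lam * β * α ^ d`; the
  -- difference of their logarithms is `(d - 1) * (log β - log α)`.
  have hlogα : Real.log (1 - α) = Real.log lam + Real.log α + d * Real.log β := by
    have : 1 - α = lam * α * β ^ d := by linarith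
    rw [this, Real.log_mul (by positivity) (by positivity), Real.log_mul hlam hα.ne', Real.log_pow]
  have hlogβ : Real.log (1 - β) = Real.log lam + Real.log β + d * Real.log α := by
    have : 1 - β = lam * β * α ^ d := by linarith
    rw [this, Real.log_mul (by positivity) (by positivity), Real.log_mul hlam hβ0.ne', Real.log_pow]
  have h3 := sqrt_mul_log_le (x := 1 - α) (y := 1 - β) (by linarith) (by linarith)
  have h4 := le_log_sub_log hα hαβ.le
  rw [← hg, hlogα, hlogβ] at h3
  set D := Real.log β - Real.log α with hD
  have h5 : g * ((d - 1) * D) ≤ β - α := by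
    have : Real.log lam + Real.log α + d * Real.log β - (Real.log lam + Real.log β + d * Real.log α)
      = (d - 1) * D := by rw [hD]; ring
    rw [this] at h3
    linarith
  have hg0 : 0 ≤ g := Real.sqrt_nonneg _
  have h6 : g * (d - 1) * (2 * (β - α)) ≤ (α + β) * (β - α) := by
    calc g * (d - 1) * (2 * (β - α)) ≤ g * (d - 1) * ((α + β) * D) :=
          mul_le_mul_of_nonneg_left h4 (mul_nonneg hg0 (by linarith))
      _ = (α + β) * (g * ((d - 1) * D)) := by ring
      _ ≤ (α + β) * (β - α) := mul_le_mul_of_nonneg_left h5 (by linarith)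
  have h7 : 2 * (g * (d - 1)) ≤ α + β := by
    refine le_of_mul_le_mul_right ?_ (sub_pos.2 hαβ)
    linarith
  -- Strict AM-GM, as `α ≠ β`. Adding `h7` gives `2 * d * g < 2`.
  have h8 : 2 * g < (1 - α) + (1 - β) := by
    have hsq : g ^ 2 = (1 - α) * (1 - β) := Real.sq_sqrt (mul_nonneg (by linarith) (by linarith))
    refine lt_of_pow_lt_pow_left₀ 2 (by linarith) ?_
    nlinarith [sq_pos_of_pos (sub_pos.2 hαβ)]
  linarith

/-- Above the critical activity the recursion has an attracting two-cycle, to which the extreme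
boundary conditions converge. -/
theorem exists_cycle (hd : 2 ≤ d) (hlam : (d : ℝ) ^ d / ((d : ℝ) - 1) ^ (d + 1) < lam) :
    ∃ α β : ℝ, 0 < α ∧ α < 1 ∧ 0 < β ∧ β < 1 ∧ vacMap d lam α = β ∧ vacMap d lam β = α ∧
      Tendsto (fun l => (vacBounds d lam l).1) atTop (𝓝 α) ∧
      Tendsto (fun l => (vacBounds d lam l).2) atTop (𝓝 β) ∧
      (∀ l, (vacBounds d lam l).1 ≤ α) ∧ (∀ l, β ≤ (vacBounds d lam l).2) ∧
      d * √((1 - α) * (1 - β)) < 1 := by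
  have hd0 : d ≠ 0 := by omega
  have hd' : (2 : ℝ) ≤ d := by exact_mod_cast hd
  have hlam0 : (0 : ℝ) < lam := lt_of_le_of_lt
    (div_nonneg (by positivity) (pow_nonneg (by linarith) _)) hlam
  have hlam0' : 0 < lam := by exact_mod_cast hlam0
  have hmono : Monotone fun l => (vacBounds d lam l).1 :=
    monotone_nat_of_le_succ fun l => (vacBounds_step hd0 l).1
  have hanti : Antitone fun l => (vacBounds d lam l).2 :=
    antitone_nat_of_succ_le fun l => (vacBounds_step hd0 l).2
  have hbdd : BddAbove (Set.range fun l => (vacBounds d lam l).1) :=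
    ⟨1, by rintro _ ⟨l, rfl⟩; exact (vacBounds_le l).trans (vacBounds_snd_le_one l)⟩
  have hbdd' : BddBelow (Set.range fun l => (vacBounds d lam l).2) :=
    ⟨0, by rintro _ ⟨l, rfl⟩; exact (vacBounds_fst_nonneg l).2⟩
  have hα := tendsto_atTop_ciSup hmono hbdd
  have hβ := tendsto_atTop_ciInf hanti hbdd'
  have hloα := fun l => le_ciSup hbdd l
  have hhiβ := fun l => ciInf_le hbdd' l
  set α := ⨆ l, (vacBounds d lam l).1 with hαdef
  set β := ⨅ l, (vacBounds d lam l).2 with hβdef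
  have hα0 : 0 < α := lt_of_lt_of_le (vacMap_pos (d := d) (lam := lam) zero_le_one) (hloα 1)
  have hαβ : α ≤ β := le_of_tendsto_of_tendsto' hα hβ vacBounds_le
  have hβ0 : 0 < β := hα0.trans_le hαβ
  have h1 : vacMap d lam α = β :=
    tendsto_nhds_unique ((continuousAt_vacMap hα0.le).tendsto.comp hα)
      (hβ.comp (tendsto_add_atTop_nat 1))
  have h2 : vacMap d lam β = α :=
    tendsto_nhds_unique ((continuousAt_vacMap hβ0.le).tendsto.comp hβ)
      (hα.comp (tendsto_add_atTop_nat 1))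
  have hβ1 : β < 1 := by
    rw [← h1, ← vacMap_zero (lam := lam) hd0]
    exact vacMap_strictAnti hd0 hlam0' le_rfl hα0
  -- Otherwise `α` is a fixed point at which the twice-iterated recursion has slope above one; it
  -- would push the lower bounds away from `α`, against their monotonicity.
  have hne : α ≠ β := by
    intro he
    have hf : vacMap d lam α = α := h1.trans he.symm
    -- Staying off `α` makes the slope at `α` meaningful along the sequence.
    have hstrict : ∀ l, (vacBounds d lam l).1 < α ∧ α < (vacBounds d lam l).2 := by
      intro l
      induction l with
      | zero => exact ⟨hα0, he ▸ hβ1⟩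
      | succ l ih =>
        constructor
        · have := vacMap_strictAnti (lam := lam) hd0 hlam0' hα0.le ih.2
          rwa [hf] at this
        · have := vacMap_strictAnti (lam := lam) hd0 hlam0' (vacBounds_fst_nonneg l).1 ih.1
          rwa [hf] at this
    have hder := hasDerivAt_vacMap_fixed hd0 hα0 hf
    have hder2 : HasDerivAt (vacMap d lam ∘ vacMap d lam)
        (-(d * (1 - α)) * -(d * (1 - α))) α := by
      refine HasDerivAt.comp α ?_ hder
      rw [hf]; exact hder
    have hgt := one_lt_of_fixed hd hlam hα0 hf
    have hslope := hasDerivAt_iff_tendsto_slope.1 hder2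
    have hev : ∀ᶠ x in 𝓝[≠] α, 1 < slope (vacMap d lam ∘ vacMap d lam) α x :=
      hslope.eventually_const_lt (by nlinarith)
    have hlim : Tendsto (fun l => (vacBounds d lam l).1) atTop (𝓝[≠] α) :=
      tendsto_nhdsWithin_iff.2 ⟨hα, Eventually.of_forall fun l => (hstrict l).1.ne⟩
    obtain ⟨l, hl⟩ := (hlim.eventually hev).exists
    rw [slope_def_field, Function.comp_apply, Function.comp_apply, hf, hf,
      lt_div_iff_of_neg (by linarith [(hstrict l).1])] at hl
    have := hmono (Nat.le_add_right l 2)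
    have h3 : (vacBounds d lam (l + 2)).1 = vacMap d lam (vacMap d lam (vacBounds d lam l).1) := rfl
    dsimp only at this
    rw [h3] at this
    linarith
  have hlt : α < β := lt_of_le_of_ne hαβ hne
  exact ⟨α, β, hα0, hlt.trans hβ1, hβ0, hβ1, h1, h2, hα, hβ, hloα, hhiβ,
    cycle_attracting hd hα0 hlt hβ1 h1 h2⟩

end Cycle

/-! ### Contraction of the recursion in logarithmic coordinates. -/

section Dynamics

/-- The recursion in terms of the negative logarithm of the probability of a vacant root. -/
noncomputable def logVacMap (lam : ℝ≥0) (s : ℝ) : ℝ := Real.log (1 + lam * Real.exp (-s))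

/-- A sequence of period two solving the recursion, along which the recursion is attracting. -/
structure AttractingCycle (d : ℕ) (lam : ℝ≥0) (c : ℕ → ℝ) : Prop where
  pos : ∀ n, 0 < c n
  lt_one : ∀ n, c n < 1
  period : ∀ n, c (n + 2) = c n
  map : ∀ n, vacMap d lam (c n) = c (n + 1)
  attracting : ∀ n, d * √((1 - c n) * (1 - c (n + 1))) < 1

/-- The limiting value of the negative logarithm of the probability of a vacant root. -/
noncomputable def cycleLog (c : ℕ → ℝ) (n : ℕ) : ℝ := -Real.log (c n)

/-- The scale on which deviations from the cycle are measured. -/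
noncomputable def cycleScale (c : ℕ → ℝ) (n : ℕ) : ℝ := √(1 - c n)

variable {d : ℕ} {lam : ℝ≥0} {c : ℕ → ℝ}

theorem hasDerivAt_logVacMap (s : ℝ) : HasDerivAt (logVacMap lam)
    (-(lam * Real.exp (-s) / (1 + lam * Real.exp (-s)))) s := by
  have h := ((((hasDerivAt_neg s).exp).const_mul (lam : ℝ)).const_add 1).log
    (by positivity)
  refine h.congr_deriv ?_
  ring

/-- The constant is below one but does not survive summation over `d` children; it serves when a
single child deviates strongly. -/
theorem logVacMap_lipschitz {s t : ℝ} (hs : 0 ≤ s) (ht : 0 ≤ t) :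
    |logVacMap lam s - logVacMap lam t| ≤ lam / (1 + lam) * |s - t| := by
  refine (convex_Ici (0 : ℝ)).norm_image_sub_le_of_norm_hasDerivWithin_le
    (fun x _ => (hasDerivAt_logVacMap x).hasDerivWithinAt) (fun x hx => ?_) ht hs
  rw [norm_neg, Real.norm_of_nonneg (by positivity), div_le_div_iff₀ (by positivity) (by positivity)]
  have h1 : Real.exp (-x) ≤ 1 := Real.exp_le_one_iff.2 (by simpa using hx)
  have h2 : (lam : ℝ) * Real.exp (-x) ≤ lam * 1 := mul_le_mul_of_nonneg_left h1 lam.coe_nonneg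
  nlinarith

theorem exists_abs_sub_le_of_hasDerivAt {f : ℝ → ℝ} {f' x C : ℝ} (h : HasDerivAt f f' x)
    (hC : |f'| < C) : ∃ δ > 0, ∀ y, |y - x| ≤ δ → |f y - f x| ≤ C * |y - x| := by
  have h1 : ∀ᶠ y in 𝓝[≠] x, |slope f x y| < C :=
    (hasDerivAt_iff_tendsto_slope.1 h).abs.eventually_lt_const hC
  rw [eventually_nhdsWithin_iff, Metric.eventually_nhds_iff] at h1
  obtain ⟨δ, hδ, h1⟩ := h1
  refine ⟨δ / 2, by positivity, fun y hy => ?_⟩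
  rcases eq_or_ne y x with rfl | hne
  · simp
  · have h2 := h1 (show dist y x < δ by rw [Real.dist_eq]; linarith) hne
    rw [slope_def_field, abs_div, div_lt_iff₀ (abs_pos.2 (sub_ne_zero.2 hne))] at h2
    exact h2.le

namespace AttractingCycle

theorem cycleLog_pos (h : AttractingCycle d lam c) (n : ℕ) : 0 < cycleLog c n :=
  neg_pos.2 (Real.log_neg (h.pos n) (h.lt_one n))

theorem cycleScale_pos (h : AttractingCycle d lam c) (n : ℕ) : 0 < cycleScale c n :=
  Real.sqrt_pos.2 (sub_pos.2 (h.lt_one n))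

theorem cycleScale_le_one (h : AttractingCycle d lam c) (n : ℕ) : cycleScale c n ≤ 1 :=
  Real.sqrt_le_one.2 (by linarith [h.pos n])

theorem logVacMap_cycleLog (h : AttractingCycle d lam c) (n : ℕ) :
    logVacMap lam (d * cycleLog c n) = cycleLog c (n + 1) := by
  rw [cycleLog, cycleLog, ← h.map n, logVacMap, vacMap, one_div, Real.log_inv, neg_neg, mul_neg,
    neg_neg, ← Real.log_pow, Real.exp_log (pow_pos (h.pos n) d)]

/-- The derivative at the cycle has modulus `1 - c (n + 1)`, which is the ratio of consecutive
scales times `√((1 - c n) * (1 - c (n + 1)))`. Measuring deviations in units of `cycleScale` thus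
turns contraction over a full period into contraction at every step. -/
theorem exists_logVacMap_contraction_step (h : AttractingCycle d lam c) (hd : d ≠ 0) (n : ℕ) {γ : ℝ}
    (hγ : d * √((1 - c n) * (1 - c (n + 1))) < γ) : ∃ δ > 0, ∀ s, |s - d * cycleLog c n| ≤ δ →
      |logVacMap lam s - cycleLog c (n + 1)| ≤
        γ / d * (cycleScale c (n + 1) / cycleScale c n) * |s - d * cycleLog c n| := by
  have hd' : (0 : ℝ) < d := by exact_mod_cast Nat.pos_of_ne_zero hd
  rw [← h.logVacMap_cycleLog n]
  refine exists_abs_sub_le_of_hasDerivAt (hasDerivAt_logVacMap _) ?_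
  rw [abs_neg, abs_of_nonneg (by positivity)]
  have h1 : (lam : ℝ) * Real.exp (-(d * cycleLog c n)) / (1 + lam * Real.exp (-(d * cycleLog c n)))
      = cycleScale c (n + 1) / cycleScale c n * √((1 - c n) * (1 - c (n + 1))) := by
    have hw := (h.cycleScale_pos n).ne'
    rw [Real.sqrt_mul (sub_nonneg.2 (h.lt_one n).le), ← cycleScale, ← cycleScale]
    rw [show cycleScale c (n + 1) / cycleScale c n * (cycleScale c n * cycleScale c (n + 1)) =
      cycleScale c (n + 1) ^ 2 by field_simp, cycleScale,
      Real.sq_sqrt (sub_nonneg.2 (h.lt_one (n + 1)).le), ← h.map n, vacMap, cycleLog, mul_neg,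
      neg_neg, ← Real.log_pow, Real.exp_log (pow_pos (h.pos n) d)]
    have := h.pos n
    field_simp
    ring
  rw [h1, mul_comm]
  refine mul_lt_mul_of_pos_right ?_ (div_pos (h.cycleScale_pos _) (h.cycleScale_pos _))
  rwa [lt_div_iff₀ hd', mul_comm]

theorem exists_contraction (h : AttractingCycle d lam c) (hd : d ≠ 0) :
    ∃ γ ε : ℝ, 0 < γ ∧ γ < 1 ∧ 0 < ε ∧ ∀ t ≤ ε, ∀ (n : ℕ) (V : Fin d → ℝ),
      (∀ i, |V i - cycleLog c n| ≤ t * cycleScale c n) →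
        |logVacMap lam (∑ i, V i) - cycleLog c (n + 1)| ≤ γ * t * cycleScale c (n + 1) := by
  have hd' : (0 : ℝ) < d := by exact_mod_cast Nat.pos_of_ne_zero hd
  -- The attraction quantity is symmetric in the two cycle values, so one rate serves both parities.
  obtain ⟨γ, hγ0, hγ1⟩ := exists_between (h.attracting 0)
  have hγpos : 0 < γ := lt_of_le_of_lt (by positivity) hγ0
  have hγ0' : d * √((1 - c 1) * (1 - c (1 + 1))) < γ := by
    rwa [show c (1 + 1) = c 0 from h.period 0, mul_comm (1 - c 1)]
  obtain ⟨δ₀, hδ₀, h₀⟩ := h.exists_logVacMap_contraction_step hd 0 hγ0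
  obtain ⟨δ₁, hδ₁, h₁⟩ := h.exists_logVacMap_contraction_step hd 1 hγ0'
  have key : ∀ n s, |s - d * cycleLog c n| ≤ min δ₀ δ₁ →
      |logVacMap lam s - cycleLog c (n + 1)| ≤
        γ / d * (cycleScale c (n + 1) / cycleScale c n) * |s - d * cycleLog c n| := by
    intro n
    induction n using Nat.twoStepInduction with
    | zero => exact fun s hs => h₀ s (hs.trans (min_le_left _ _))
    | one => exact fun s hs => h₁ s (hs.trans (min_le_right _ _))
    | more n ih _ =>
      have e1 : c (n + 2 + 1) = c (n + 1) := h.period (n + 1)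
      simpa only [cycleLog, cycleScale, h.period n, e1] using ih
  refine ⟨γ, min δ₀ δ₁ / d, hγpos, hγ1, by positivity, fun t ht n V hV => ?_⟩
  have hw := h.cycleScale_pos n
  have hw' := h.cycleScale_pos (n + 1)
  have hsum : |∑ i, V i - d * cycleLog c n| ≤ d * (t * cycleScale c n) := by
    have : ∑ i, V i - d * cycleLog c n = ∑ i, (V i - cycleLog c n) := by simp
    rw [this]
    refine (Finset.abs_sum_le_sum_abs _ _).trans ((Finset.sum_le_sum fun i _ => hV i).trans ?_)
    simp
  have ht0 : 0 ≤ t * cycleScale c n :=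
    (abs_nonneg _).trans (hV ⟨0, Nat.pos_of_ne_zero hd⟩)
  have ht1 : 0 ≤ t := nonneg_of_mul_nonneg_left ht0 hw
  have hle : d * (t * cycleScale c n) ≤ min δ₀ δ₁ := by
    rw [le_div_iff₀ hd'] at ht
    have : t * cycleScale c n ≤ t * 1 := mul_le_mul_of_nonneg_left (h.cycleScale_le_one n) ht1
    nlinarith
  refine (key n _ (hsum.trans hle)).trans ?_
  refine (mul_le_mul_of_nonneg_left hsum (by positivity)).trans (le_of_eq ?_)
  field_simp

/-- The exceptional child is charged once, every other child at most `ε`; no smallness of `T` is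
required. -/
theorem abs_logVacMap_sub_le (h : AttractingCycle d lam c) {n : ℕ} {V : Fin d → ℝ} {ε T : ℝ}
    (hε : 0 ≤ ε) (hV : ∀ i, 0 ≤ V i) (j : Fin d) (hne : ∀ i, i ≠ j → |V i - cycleLog c n| ≤ ε)
    (hj : |V j - cycleLog c n| ≤ T) :
    |logVacMap lam (∑ i, V i) - cycleLog c (n + 1)| ≤ lam / (1 + lam) * (T + d * ε) := by
  rw [← h.logVacMap_cycleLog n]
  have := (h.cycleLog_pos n).le
  refine (logVacMap_lipschitz (Finset.sum_nonneg fun i _ => hV i) (by positivity)).trans ?_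
  refine mul_le_mul_of_nonneg_left ?_ (by positivity)
  have : ∑ i, V i - d * cycleLog c n = ∑ i, (V i - cycleLog c n) := by simp
  rw [this, ← Finset.add_sum_erase _ _ (Finset.mem_univ j)]
  refine (abs_add_le _ _).trans (add_le_add hj ?_)
  refine (Finset.abs_sum_le_sum_abs _ _).trans
    ((Finset.sum_le_sum fun i hi => hne i (Finset.ne_of_mem_erase hi)).trans ?_)
  rw [Finset.sum_const, nsmul_eq_mul]
  refine mul_le_mul_of_nonneg_right ?_ hε
  exact_mod_cast (Finset.card_le_univ _).trans (by simp)

/-- Thresholds through which the effect of a single large deviation decreases level by level, as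
long as all the other deviations are small. -/
theorem exists_thresholds (h : AttractingCycle d lam c) {γ ε₀ : ℝ} (hγ0 : 0 < γ) (hγ1 : γ < 1)
    (hε₀ : 0 < ε₀) (hcontr : ∀ t ≤ ε₀, ∀ (n : ℕ) (V : Fin d → ℝ),
      (∀ i, |V i - cycleLog c n| ≤ t * cycleScale c n) →
        |logVacMap lam (∑ i, V i) - cycleLog c (n + 1)| ≤ γ * t * cycleScale c (n + 1))
    {M : ℝ} (hM : 0 ≤ M) :
    ∃ (ε : ℝ) (K : ℕ) (t : ℕ → ℕ → ℝ), 0 < ε ∧ ε ≤ ε₀ ∧ 0 < K ∧ (∀ n, M ≤ t 0 n) ∧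
      (∀ n, t K n ≤ ε * cycleScale c n) ∧
      ∀ (i n : ℕ) (V : Fin d → ℝ) (j : Fin d), (∀ k, 0 ≤ V k) →
        (∀ k, k ≠ j → |V k - cycleLog c n| ≤ ε * cycleScale c n) →
        |V j - cycleLog c n| ≤ t i n →
          |logVacMap lam (∑ k, V k) - cycleLog c (n + 1)| ≤ t (i + 1) (n + 1) := by
  set m := min (cycleScale c 0) (cycleScale c 1) with hm
  have hm0 : 0 < m := lt_min (h.cycleScale_pos 0) (h.cycleScale_pos 1)
  have hmle : ∀ n, m ≤ cycleScale c n := by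
    intro n
    induction n using Nat.twoStepInduction with
    | zero => exact min_le_left _ _
    | one => exact min_le_right _ _
    | more n ih _ => simpa only [cycleScale, h.period n] using ih
  set θ : ℝ := lam / (1 + lam) with hθ
  have hθ0 : 0 ≤ θ := by positivity
  have hθ1 : θ < 1 := by
    rw [hθ, div_lt_one (by positivity)]; linarith
  have hθ1' : 0 < 1 - θ := by linarith
  -- The quantity bounded here is the fixed point of `T ↦ θ * (T + d * ε)`. It must lie well inside
  -- the region where the local contraction applies.
  obtain ⟨ε, hε, hεε₀, hεB⟩ : ∃ ε : ℝ, 0 < ε ∧ ε ≤ ε₀ ∧ θ * (d * ε) / (1 - θ) ≤ ε₀ * m / 2 := by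
    refine ⟨min ε₀ (ε₀ * m / 2 * (1 - θ) / (d + 1)), by positivity, min_le_left _ _, ?_⟩
    rw [div_le_iff₀ hθ1']
    have h1 : min ε₀ (ε₀ * m / 2 * (1 - θ) / (d + 1)) ≤ ε₀ * m / 2 * (1 - θ) / (d + 1) :=
      min_le_right _ _
    have h0 : 0 ≤ min ε₀ (ε₀ * m / 2 * (1 - θ) / (d + 1)) := by positivity
    rw [le_div_iff₀ (by positivity)] at h1
    have h2 : (d : ℝ) * min ε₀ (ε₀ * m / 2 * (1 - θ) / (d + 1)) ≤ ε₀ * m / 2 * (1 - θ) := by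
      linarith
    exact (mul_le_of_le_one_left (by positivity) hθ1.le).trans h2
  set B := θ * (d * ε) / (1 - θ) with hB
  have hB0 : 0 ≤ B := by positivity
  have hBeq : B = θ * B + θ * (d * ε) := by rw [hB]; field_simp; ring
  -- `K₁` Lipschitz steps bring `M` into the contraction region; `K₂` contraction steps then bring
  -- `ε₀` down to `ε`.
  obtain ⟨K₁, hK₁⟩ := exists_pow_lt_of_lt_one (show 0 < ε₀ * m / 2 / (M + 1) by positivity) hθ1
  obtain ⟨K₂, hK₂⟩ := exists_pow_lt_of_lt_one (show 0 < ε / ε₀ by positivity) hγ1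
  have hT : θ ^ K₁ * M + B ≤ ε₀ * m := by
    rw [lt_div_iff₀ (by positivity)] at hK₁
    have : 0 ≤ θ ^ K₁ := by positivity
    nlinarith
  have hanti : ∀ i, θ ^ (i + 1) ≤ θ ^ i := fun i => pow_le_pow_of_le_one hθ0 hθ1.le (Nat.le_succ i)
  set S : ℕ → ℝ := fun i => θ ^ i * M + B with hS
  -- The floor `ε` is needed because the other children may deviate that much at every step.
  set R : ℕ → ℝ := fun i => max (γ ^ i * ε₀) ε with hR
  have hRε₀ : ∀ i, R i ≤ ε₀ := fun i =>
    max_le (mul_le_of_le_one_left hε₀.le (pow_le_one₀ hγ0.le hγ1.le)) hεε₀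
  have hRstep : ∀ i, γ * R i ≤ R (i + 1) := by
    intro i
    rw [hR]
    dsimp only
    rw [mul_max_of_nonneg _ _ hγ0.le]
    refine max_le_max (le_of_eq (by ring)) (mul_le_of_le_one_left hε.le hγ1.le)
  have hstepS : ∀ (i n : ℕ) (V : Fin d → ℝ) (j : Fin d), (∀ k, 0 ≤ V k) →
        (∀ k, k ≠ j → |V k - cycleLog c n| ≤ ε * cycleScale c n) → |V j - cycleLog c n| ≤ S i →
          |logVacMap lam (∑ k, V k) - cycleLog c (n + 1)| ≤ S (i + 1) := by
    intro i n V j hV hk hj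
    refine (h.abs_logVacMap_sub_le hε.le hV j (fun k hkj => (hk k hkj).trans
      (mul_le_of_le_one_right hε.le (h.cycleScale_le_one n))) hj).trans (le_of_eq ?_)
    rw [← hθ]
    simp only [hS, pow_succ]
    linear_combination -hBeq
  have hS0 : ∀ n, S K₁ ≤ R 0 * cycleScale c n := fun n => by
    have h1 : ε₀ ≤ R 0 := by simp [hR]
    calc S K₁ ≤ ε₀ * m := hT
      _ ≤ R 0 * cycleScale c n := mul_le_mul h1 (hmle n) hm0.le (hε₀.le.trans h1)
  refine ⟨ε, K₁ + 1 + K₂, fun i n => if i ≤ K₁ then S i else R (i - (K₁ + 1)) * cycleScale c n,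
    hε, hεε₀, by omega, fun n => ?_, fun n => ?_, fun i n V j hV hk hj => ?_⟩
  · simp [hS, hB0]
  · dsimp only
    rw [if_neg (by omega), Nat.add_sub_cancel_left]
    refine mul_le_mul_of_nonneg_right (max_le ?_ le_rfl) (h.cycleScale_pos n).le
    rw [lt_div_iff₀ hε₀] at hK₂
    exact hK₂.le
  · dsimp only at hj ⊢
    rcases lt_trichotomy i K₁ with hi | rfl | hi
    · rw [if_pos (by omega)]
      rw [if_pos (by omega)] at hj
      exact hstepS i n V j hV hk hj
    · rw [if_neg (by omega), Nat.sub_self]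
      rw [if_pos le_rfl] at hj
      refine (hstepS i n V j hV hk hj).trans (le_trans ?_ (hS0 (n + 1)))
      simp only [hS]
      gcongr ?_ * M + B
      exact hanti i
    · rw [if_neg (by omega), show i + 1 - (K₁ + 1) = i - (K₁ + 1) + 1 by omega]
      rw [if_neg (by omega)] at hj
      refine (hcontr (R (i - (K₁ + 1))) (hRε₀ _) n V fun k => ?_).trans
        (mul_le_mul_of_nonneg_right (hRstep _) (h.cycleScale_pos _).le)
      rcases eq_or_ne k j with rfl | hkj
      · exact hj
      · exact (hk k hkj).trans (mul_le_mul_of_nonneg_right (le_max_right _ _)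
          (h.cycleScale_pos n).le)

end AttractingCycle

end Dynamics

/-! ### Tail bounds: propagation from the branches to the root, and the initial estimate. -/

section Tails

variable {d : ℕ} {lam : ℝ≥0} {c : ℕ → ℝ}

/-- The negative logarithm of the conditional probability that the root is vacant. -/
noncomputable def logVac (d : ℕ) (lam : ℝ≥0) (l : ℕ) (σ : TreeVertex d → Bool) : ℝ :=
  -Real.log (condVac d lam l σ)

/-- The recursion is decreasing in each branch, so lower and upper bounds exchange roles at each
level. -/
theorem condVac_mem_vacBounds (l : ℕ) (σ : TreeVertex d → Bool) :
    (vacBounds d lam l).1 ≤ condVac d lam l σ ∧ condVac d lam l σ ≤ (vacBounds d lam l).2 := by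
  induction l generalizing σ with
  | zero => exact ⟨rootVacant_nonneg σ, rootVacant_le_one σ⟩
  | succ l ih =>
    have hlo := (vacBounds_fst_nonneg (d := d) (lam := lam) l).1
    have h1 : (vacBounds d lam l).1 ^ d ≤ ∏ i, condVac d lam l (branch σ i) := by
      simpa using Finset.prod_le_prod (s := Finset.univ) (fun i _ => hlo)
        fun i _ => (ih (branch σ i)).1
    have h2 : ∏ i, condVac d lam l (branch σ i) ≤ (vacBounds d lam l).2 ^ d := by
      simpa using Finset.prod_le_prod (s := Finset.univ) (fun i _ => condVac_nonneg lam l _)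
        fun i _ => (ih (branch σ i)).2
    have h0 : 0 ≤ (vacBounds d lam l).1 ^ d := pow_nonneg hlo d
    have h3 := mul_le_mul_of_nonneg_left h1 lam.coe_nonneg
    have h4 := mul_le_mul_of_nonneg_left h2 lam.coe_nonneg
    have h5 := mul_nonneg lam.coe_nonneg h0
    exact ⟨one_div_le_one_div_of_le (by linarith) (by linarith),
      one_div_le_one_div_of_le (by linarith) (by linarith)⟩

theorem one_div_le_vacMap {u : ℝ} (hu : 0 ≤ u) (hu1 : u ≤ 1) : 1 / (1 + lam) ≤ vacMap d lam u := by
  refine (le_of_eq ?_).trans (vacMap_anti hu hu1)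
  simp [vacMap]

theorem condVac_le_one (l : ℕ) (σ : TreeVertex d → Bool) : condVac d lam l σ ≤ 1 :=
  (condVac_mem_vacBounds l σ).2.trans (vacBounds_snd_le_one l)

theorem one_div_le_condVac {l : ℕ} (hl : l ≠ 0) (σ : TreeVertex d → Bool) :
    1 / (1 + lam) ≤ condVac d lam l σ := by
  obtain ⟨l, rfl⟩ := Nat.exists_eq_add_one_of_ne_zero hl
  exact (one_div_le_vacMap (vacBounds_fst_nonneg l).2 (vacBounds_snd_le_one l)).trans
    (condVac_mem_vacBounds (l + 1) σ).1

theorem condVac_pos {l : ℕ} (hl : l ≠ 0) (σ : TreeVertex d → Bool) :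
    0 < condVac d lam l σ :=
  lt_of_lt_of_le (by positivity) (one_div_le_condVac hl σ)

theorem logVac_nonneg (l : ℕ) (σ : TreeVertex d → Bool) : 0 ≤ logVac d lam l σ :=
  neg_nonneg.2 (Real.log_nonpos (condVac_nonneg lam l σ) (condVac_le_one l σ))

theorem logVac_le {l : ℕ} (hl : l ≠ 0) (σ : TreeVertex d → Bool) :
    logVac d lam l σ ≤ Real.log (1 + lam) := by
  have h := Real.log_le_log (by positivity) (one_div_le_condVac (lam := lam) hl σ)
  rw [one_div, Real.log_inv] at h
  rw [logVac]
  linarith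

/-- At level zero `condVac` can vanish and `Real.log 0 = 0` would break the identity, hence `l ≠ 0`.
-/
theorem logVac_succ {l : ℕ} (hl : l ≠ 0) (σ : TreeVertex d → Bool) :
    logVac d lam (l + 1) σ = logVacMap lam (∑ i, logVac d lam l (branch σ i)) := by
  have h : Real.exp (-∑ i, logVac d lam l (branch σ i)) = ∏ i, condVac d lam l (branch σ i) := by
    rw [← Finset.sum_neg_distrib, Real.exp_sum]
    refine Finset.prod_congr rfl fun i _ => ?_
    rw [logVac, neg_neg, Real.exp_log (condVac_pos hl _)]
  rw [logVacMap, h, logVac, condVac, one_div, Real.log_inv, neg_neg]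

theorem treeGibbs_real_branch_le (lam : ℝ≥0) (L : ℕ) (B : Set (TreeVertex d → Bool)) (i : Fin d) :
    (treeGibbs d lam (L + 1) : Measure (TreeVertex d → Bool)).real {σ | branch σ i ∈ B} ≤
      (1 + lam) * (treeGibbs d lam L : Measure (TreeVertex d → Bool)).real B := by
  rw [treeGibbs_real, treeGibbs_real]
  exact treeMean_succ_branch_le lam L (f := B.indicator 1)
    (fun σ => Set.indicator_nonneg (fun _ _ => zero_le_one) σ) i

theorem treeGibbs_real_two_branches_le (lam : ℝ≥0) (L : ℕ) (B : Set (TreeVertex d → Bool))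
    {i j : Fin d} (hij : i ≠ j) :
    (treeGibbs d lam (L + 1) : Measure (TreeVertex d → Bool)).real
        {σ | branch σ i ∈ B ∧ branch σ j ∈ B} ≤
      (1 + lam) * (treeGibbs d lam L : Measure (TreeVertex d → Bool)).real B ^ 2 := by
  rw [treeGibbs_real, treeGibbs_real]
  refine le_trans (le_of_eq (treeMean_congr fun σ => ?_)) (treeMean_succ_branch_mul_branch_le lam L
    (f := B.indicator 1) (fun σ => Set.indicator_nonneg (fun _ _ => zero_le_one) σ) hij)
  by_cases hi : branch σ i ∈ B <;> by_cases hj : branch σ j ∈ B <;> simp [hi, hj]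

/-- A bound, uniform in the height of the tree, for the probability that the logarithm of the
conditional probability of a vacant root given level `l` deviates from the cycle. -/
def TailBound (d : ℕ) (lam : ℝ≥0) (c : ℕ → ℝ) (l : ℕ) (t : ℕ → ℝ) (x : ℝ) : Prop :=
  ∀ L ≥ l, (treeGibbs d lam L : Measure (TreeVertex d → Bool)).real
    {σ | t L < |logVac d lam l σ - cycleLog c L|} ≤ x

theorem TailBound.mono {l : ℕ} {t t' : ℕ → ℝ} {x x' : ℝ} (h : TailBound d lam c l t x)
    (ht : ∀ n, t n ≤ t' n) (hx : x ≤ x') : TailBound d lam c l t' x' := fun L hL =>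
  (measureReal_mono fun _ hσ => (ht L).trans_lt hσ).trans ((h L hL).trans hx)

/-- A union bound over the branches, each costing a factor `1 + lam`. Thresholds and cycle are
indexed by the tree height, which drops by one on passing to a branch. -/
theorem TailBound.contract {l : ℕ} (hl : l ≠ 0) {t t' : ℕ → ℝ} {x : ℝ}
    (h : TailBound d lam c l t x)
    (hstep : ∀ (n : ℕ) (V : Fin d → ℝ), (∀ i, |V i - cycleLog c n| ≤ t n) →
      |logVacMap lam (∑ i, V i) - cycleLog c (n + 1)| ≤ t' (n + 1)) :
    TailBound d lam c (l + 1) t' (d * (1 + lam) * x) := by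
  intro L hL
  obtain ⟨L, rfl⟩ := Nat.exists_eq_add_one_of_ne_zero (by omega : L ≠ 0)
  set B : Set (TreeVertex d → Bool) := {σ | t L < |logVac d lam l σ - cycleLog c L|} with hB
  have hsub : {σ | t' (L + 1) < |logVac d lam (l + 1) σ - cycleLog c (L + 1)|} ⊆
      ⋃ i ∈ (Finset.univ : Finset (Fin d)), {σ | branch σ i ∈ B} := by
    intro σ hσ
    simp only [Finset.mem_univ, Set.iUnion_true, Set.mem_iUnion, Set.mem_ofPred_eq]
    by_contra! hcon
    simp only [hB, Set.mem_ofPred_eq, not_lt] at hcon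
    have := hstep L (fun i => logVac d lam l (branch σ i)) hcon
    rw [← logVac_succ hl] at this
    exact absurd hσ (not_lt.2 this)
  refine (measureReal_mono hsub (measure_ne_top _ _)).trans ((measureReal_biUnion_finset_le _ _).trans ?_)
  refine (Finset.sum_le_sum fun i _ => (treeGibbs_real_branch_le lam L B i).trans
    (mul_le_mul_of_nonneg_left (h L (by omega)) (by positivity))).trans (le_of_eq ?_)
  simp
  ring

/-- Failure at the root needs one branch beyond `t`, at linear cost in `y`, or two branches beyond
`s`, at quadratic cost in `x`. -/
theorem TailBound.contract_of_one_bad (hd : d ≠ 0) {l : ℕ} (hl : l ≠ 0) {s t t' : ℕ → ℝ} {x y : ℝ}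
    (hs : TailBound d lam c l s x) (ht : TailBound d lam c l t y) (hy : 0 ≤ y)
    (hstep : ∀ (n : ℕ) (V : Fin d → ℝ) (j : Fin d), (∀ k, 0 ≤ V k) →
      (∀ k, k ≠ j → |V k - cycleLog c n| ≤ s n) → |V j - cycleLog c n| ≤ t n →
        |logVacMap lam (∑ k, V k) - cycleLog c (n + 1)| ≤ t' (n + 1)) :
    TailBound d lam c (l + 1) t' ((1 + lam) * d ^ 2 * (y + x ^ 2)) := by
  intro L hL
  obtain ⟨L, rfl⟩ := Nat.exists_eq_add_one_of_ne_zero (by omega : L ≠ 0)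
  set B : Set (TreeVertex d → Bool) := {σ | t L < |logVac d lam l σ - cycleLog c L|} with hB
  set G : Set (TreeVertex d → Bool) := {σ | s L < |logVac d lam l σ - cycleLog c L|} with hG
  have hd1 : (1 : ℝ) ≤ d := by exact_mod_cast Nat.pos_of_ne_zero hd
  have hx : 0 ≤ x := measureReal_nonneg.trans (hs L (by omega))
  have hsub : {σ | t' (L + 1) < |logVac d lam (l + 1) σ - cycleLog c (L + 1)|} ⊆
      (⋃ i ∈ (Finset.univ : Finset (Fin d)), {σ | branch σ i ∈ B}) ∪
      ⋃ p ∈ (Finset.univ : Finset (Fin d)).offDiag,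
        {σ | branch σ p.1 ∈ G ∧ branch σ p.2 ∈ G} := by
    intro σ hσ
    by_contra hcon
    simp only [Set.mem_union, Set.mem_iUnion, not_or, not_exists, Finset.mem_offDiag,
      Finset.mem_univ, true_and, Set.mem_ofPred_eq, Prod.forall, not_and] at hcon
    obtain ⟨h1, h2⟩ := hcon
    -- At most one branch is in `G`; if none is, any index serves as the exceptional one.
    have h3 : ∃ j, ∀ k, k ≠ j → branch σ k ∉ G := by
      by_cases he : ∃ j, branch σ j ∈ G
      · obtain ⟨j, hj⟩ := he
        exact ⟨j, fun k hk hkG => h2 k j hk hkG hj⟩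
      · exact ⟨⟨0, Nat.pos_of_ne_zero hd⟩, fun k _ hk => he ⟨k, hk⟩⟩
    obtain ⟨j, hj⟩ := h3
    have := hstep L (fun i => logVac d lam l (branch σ i)) j (fun k => logVac_nonneg l _)
      (fun k hk => not_lt.1 (hj k hk)) (not_lt.1 (h1 j trivial))
    rw [← logVac_succ hl] at this
    exact absurd hσ (not_lt.2 this)
  refine (measureReal_mono hsub (measure_ne_top _ _)).trans ((measureReal_union_le _ _).trans ?_)
  have h1 : (treeGibbs d lam (L + 1) : Measure (TreeVertex d → Bool)).real
      (⋃ i ∈ (Finset.univ : Finset (Fin d)), {σ | branch σ i ∈ B}) ≤ d * ((1 + lam) * y) := by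
    refine (measureReal_biUnion_finset_le _ _).trans ((Finset.sum_le_sum fun i _ =>
      (treeGibbs_real_branch_le lam L B i).trans
        (mul_le_mul_of_nonneg_left (ht L (by omega)) (by positivity))).trans (le_of_eq ?_))
    simp
  have h2 : (treeGibbs d lam (L + 1) : Measure (TreeVertex d → Bool)).real
      (⋃ p ∈ (Finset.univ : Finset (Fin d)).offDiag,
        {σ | branch σ p.1 ∈ G ∧ branch σ p.2 ∈ G}) ≤ d ^ 2 * ((1 + lam) * x ^ 2) := by
    refine (measureReal_biUnion_finset_le _ _).trans ((Finset.sum_le_sum fun p hp =>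
      (treeGibbs_real_two_branches_le lam L G (Finset.mem_offDiag.1 hp).2.2).trans
        (mul_le_mul_of_nonneg_left (pow_le_pow_left₀ measureReal_nonneg (hs L (by omega)) 2)
          (by positivity))).trans ?_)
    rw [Finset.sum_const, nsmul_eq_mul]
    refine mul_le_mul_of_nonneg_right ?_ (by positivity)
    rw [Finset.offDiag_card, Finset.card_univ, Fintype.card_fin]
    calc ((d * d - d : ℕ) : ℝ) ≤ ((d * d : ℕ) : ℝ) := by exact_mod_cast Nat.sub_le _ _
      _ = (d : ℝ) ^ 2 := by push_cast; ring
  have h3 : (d : ℝ) * ((1 + lam) * y) ≤ d ^ 2 * ((1 + lam) * y) :=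
    mul_le_mul_of_nonneg_right (by nlinarith) (by positivity)
  linarith

/-- One-sided Markov inequality. -/
theorem treeGibbs_real_abs_sub_le (lam : ℝ≥0) (L : ℕ) {f : (TreeVertex d → Bool) → ℝ} {a e t : ℝ}
    (ha : ∀ σ, a ≤ f σ) (hf : treeMean d lam L f ≤ e) (ht : 0 < t) (hae : e - a ≤ t / 2) :
    (treeGibbs d lam L : Measure (TreeVertex d → Bool)).real {σ | t < |f σ - e|} ≤
      2 / t * (e - a) := by
  rw [treeGibbs_real]
  have hae0 : a ≤ e := by
    rw [← treeMean_const (d := d) lam L a]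
    exact (treeMean_mono ha).trans hf
  have h1 : treeMean d lam L ({σ | t < |f σ - e|}.indicator 1) ≤
      treeMean d lam L fun σ => 2 / t * (f σ + -a) := by
    refine treeMean_mono fun σ => ?_
    have := ha σ
    by_cases h : t < |f σ - e|
    · rw [Set.indicator_of_mem (show σ ∈ {σ | t < |f σ - e|} from h), Pi.one_apply, div_mul_eq_mul_div,
        le_div_iff₀ ht]
      -- The lower tail is empty because `f ≥ a ≥ e - t / 2`; only the upper tail contributes.
      rcases lt_abs.1 h with h | h <;> linarith
    · rw [Set.indicator_of_notMem (show σ ∉ {σ | t < |f σ - e|} from h)]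
      exact mul_nonneg (by positivity) (by linarith)
  rw [treeMean_const_mul, treeMean_add, treeMean_const] at h1
  exact h1.trans (mul_le_mul_of_nonneg_left (by linarith) (by positivity))

theorem abs_log_sub_log_le {a x y : ℝ} (ha : 0 < a) (hx : 1 / a ≤ x) (hy : 1 / a ≤ y) :
    |Real.log x - Real.log y| ≤ a * |x - y| := by
  wlog hxy : y ≤ x generalizing x y
  · rw [abs_sub_comm, abs_sub_comm x]
    exact this hy hx (le_of_not_ge hxy)
  have hy0 : 0 < y := lt_of_lt_of_le (by positivity) hy
  have hx0 : 0 < x := hy0.trans_le hxy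
  rw [abs_of_nonneg (sub_nonneg.2 (Real.log_le_log hy0 hxy)), abs_of_nonneg (sub_nonneg.2 hxy),
    ← Real.log_div hx0.ne' hy0.ne']
  have h1 := Real.log_le_sub_one_of_pos (div_pos hx0 hy0)
  have h2 : x / y - 1 = (x - y) / y := by field_simp
  rw [h2] at h1
  refine h1.trans ?_
  rw [div_le_iff₀ hy0]
  rw [div_le_iff₀ ha] at hy
  nlinarith

/-- The free tree of height `L` amounts to an all-vacant level `L + 1`, an extreme boundary
condition whose side alternates with parity. -/
theorem vacProb_eq (lam : ℝ≥0) (L : ℕ) : vacProb d lam L =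
    if Even L then (vacBounds d lam (L + 1)).1 else (vacBounds d lam (L + 1)).2 := by
  induction L with
  | zero => simp [vacProb_zero, vacBounds, vacMap]
  | succ L ih =>
    rw [vacProb_succ, ih]
    by_cases h : Even L
    · have h' : ¬ Even (L + 1) := by simpa [Nat.even_add_one] using h
      rw [if_pos h, if_neg h']; rfl
    · have h' : Even (L + 1) := Nat.even_add_one.2 h
      rw [if_neg h, if_pos h']; rfl

/-- The sequence alternating between the two values. -/
noncomputable def alternate (α β : ℝ) (n : ℕ) : ℝ := if Even n then α else β

/-- Deviations from the cycle tend to zero in probability. -/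
theorem eventually_tailBound {α β : ℝ} (hc : AttractingCycle d lam (alternate α β))
    (hα : Tendsto (fun l => (vacBounds d lam l).1) atTop (𝓝 α))
    (hβ : Tendsto (fun l => (vacBounds d lam l).2) atTop (𝓝 β))
    (hlo : ∀ l, (vacBounds d lam l).1 ≤ α) (hhi : ∀ l, β ≤ (vacBounds d lam l).2)
    {ε δ : ℝ} (hε : 0 < ε) (hδ : 0 < δ) :
    ∀ᶠ l in atTop, TailBound d lam (alternate α β) l
      (fun n => ε * cycleScale (alternate α β) n) δ := by
  set c := alternate α β with hcdef
  have hcle : ∀ n, 1 / (1 + lam) ≤ c n := by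
    intro n
    rw [← hc.period n, ← hc.map (n + 1)]
    exact one_div_le_vacMap (hc.pos _).le (hc.lt_one _).le
  have hc0 : ∀ n, Even n → c n = α := fun n hn => if_pos hn
  have hc1 : ∀ n, ¬ Even n → c n = β := fun n hn => if_neg hn
  -- Division by `1 + lam` pays for the Lipschitz constant of the logarithm on `[1 / (1 + lam), ∞)`.
  set t : ℕ → ℝ := fun n => ε * cycleScale c n / (1 + lam) with ht
  have ht0 : ∀ n, 0 < t n := fun n => div_pos (mul_pos hε (hc.cycleScale_pos n)) (by positivity)
  have htα : ∀ n, Even n → t n = t 0 := fun n hn => by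
    simp only [ht, cycleScale, hc0 n hn, hc0 0 (by simp)]
  have htβ : ∀ n, ¬ Even n → t n = t 1 := fun n hn => by
    simp only [ht, cycleScale, hc1 n hn, hc1 1 (by simp)]
  have hα' : Tendsto (fun l => α - (vacBounds d lam l).1) atTop (𝓝 0) := by
    simpa using hα.const_sub α
  have hβ' : Tendsto (fun l => (vacBounds d lam l).2 - β) atTop (𝓝 0) := by
    simpa using hβ.sub_const β
  have h0 := ht0 0
  have h1 := ht0 1
  filter_upwards [hα'.eventually_lt_const (half_pos h0), hβ'.eventually_lt_const (half_pos h1),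
    hα'.eventually_lt_const (show 0 < δ * (t 0 / 2) by positivity),
    hβ'.eventually_lt_const (show 0 < δ * (t 1 / 2) by positivity), eventually_ne_atTop 0]
    with l hl0 hl1 hl2 hl3 hl L hL
  have hsub : {σ | ε * cycleScale c L < |logVac d lam l σ - cycleLog c L|} ⊆
      {σ | t L < |condVac d lam l σ - c L|} := by
    intro σ hσ
    simp only [Set.mem_ofPred_eq, ht] at hσ ⊢
    rw [div_lt_iff₀ (by positivity), mul_comm _ (1 + (lam : ℝ))]
    refine hσ.trans_le (le_trans (le_of_eq ?_) (abs_log_sub_log_le (by positivity)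
      (one_div_le_condVac hl σ) (hcle L)))
    rw [logVac, cycleLog, ← abs_neg]
    congr 1; ring
  refine (measureReal_mono hsub (measure_ne_top _ _)).trans ?_
  by_cases hpar : Even L
  · have hv : treeMean d lam L (condVac d lam l) ≤ α := by
      -- At even height the mean is at most `α`, while the pointwise lower bound increases to `α`.
      rw [treeMean_condVac lam hL, vacProb_eq, if_pos hpar]; exact hlo _
    rw [htα L hpar, hc0 L hpar]
    refine (treeGibbs_real_abs_sub_le lam L (fun σ => (condVac_mem_vacBounds l σ).1) hv h0
      hl0.le).trans ?_
    rw [div_mul_eq_mul_div, div_le_iff₀ h0]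
    linarith
  -- At odd height the mean is at least `β` and the pointwise upper bound decreases to `β`; negation
  -- reduces to the same inequality.
  · have hv : treeMean d lam L (fun σ => -1 * condVac d lam l σ) ≤ -β := by
      rw [treeMean_const_mul, treeMean_condVac lam hL, vacProb_eq, if_neg hpar]
      linarith [hhi (L + 1)]
    rw [htβ L hpar, hc1 L hpar]
    have h := treeGibbs_real_abs_sub_le lam L (a := -(vacBounds d lam l).2)
      (fun σ => by linarith [(condVac_mem_vacBounds (lam := lam) l σ).2]) hv h1 (by linarith)
    have hset : {σ | t 1 < |condVac d lam l σ - β|} =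
        {σ | t 1 < |-1 * condVac d lam l σ - -β|} := by
      ext σ
      rw [Set.mem_ofPred_eq, Set.mem_ofPred_eq, ← abs_neg]
      ring_nf
    rw [hset]
    refine h.trans ?_
    rw [div_mul_eq_mul_div, div_le_iff₀ h1]
    linarith

end Tails

/-! ### From convergence in probability to doubly exponential concentration. -/

section DoublyExponential

variable {d : ℕ} {lam : ℝ≥0} {c : ℕ → ℝ}

/-- The initial threshold is never exceeded, so the bad probability starts at zero and only the
events with two bad branches contribute, each through `x ^ 2`. -/
theorem TailBound.iterate (hd : d ≠ 0) {s : ℕ → ℝ} {t : ℕ → ℕ → ℝ} {K l : ℕ} {x : ℝ} (hl : l ≠ 0)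
    (hstep : ∀ (i n : ℕ) (V : Fin d → ℝ) (j : Fin d), (∀ k, 0 ≤ V k) →
      (∀ k, k ≠ j → |V k - cycleLog c n| ≤ s n) → |V j - cycleLog c n| ≤ t i n →
        |logVacMap lam (∑ k, V k) - cycleLog c (n + 1)| ≤ t (i + 1) (n + 1))
    (h0 : TailBound d lam c l (t 0) 0) (hs : ∀ i < K, TailBound d lam c (l + i) s x) :
    ∀ i ≤ K, TailBound d lam c (l + i) (t i) (i * ((1 + lam) * d ^ 2) ^ i * x ^ 2) := by
  have hd1 : (1 : ℝ) ≤ d := by exact_mod_cast Nat.pos_of_ne_zero hd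
  have hC : 1 ≤ (1 + (lam : ℝ)) * d ^ 2 := by
    have := lam.coe_nonneg
    nlinarith [one_le_pow₀ hd1 (n := 2)]
  intro i
  induction i with
  | zero => intro _; simpa using h0
  | succ i ih =>
    intro hi
    refine (TailBound.contract_of_one_bad hd (by omega) (hs i (by omega)) (ih (by omega))
      (by positivity) (hstep i)).mono (fun _ => le_rfl) ?_
    have h1 := le_self_pow₀ hC (Nat.succ_ne_zero i)
    have h2 : (1 + (lam : ℝ)) * d ^ 2 * x ^ 2 ≤ ((1 + (lam : ℝ)) * d ^ 2) ^ (i + 1) * x ^ 2 :=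
      mul_le_mul_of_nonneg_right h1 (sq_nonneg x)
    push_cast
    calc (1 + (lam : ℝ)) * d ^ 2 * (i * ((1 + lam) * d ^ 2) ^ i * x ^ 2 + x ^ 2)
        = i * ((1 + lam) * d ^ 2) ^ (i + 1) * x ^ 2 + (1 + (lam : ℝ)) * d ^ 2 * x ^ 2 := by ring
      _ ≤ (i + 1) * ((1 + lam) * d ^ 2) ^ (i + 1) * x ^ 2 := by linarith

/-- Tails that get squared every `K` levels decay doubly exponentially. -/
theorem TailBound.doubly_exponential {s : ℕ → ℝ} {K : ℕ} {C : ℝ} (hC : 0 < C)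
    (hinit : ∀ δ > 0, ∀ᶠ l in atTop, TailBound d lam c l s δ)
    (hstep : ∀ l ≠ 0, ∀ x, (∀ i < K, TailBound d lam c (l + i) s x) →
      TailBound d lam c (l + K) s (C * x ^ 2)) :
    ∃ l₀, ∀ m i : ℕ, m * K ≤ i → TailBound d lam c (l₀ + i) s (Real.exp (-2 ^ m) / C) := by
  -- The normalisation by `C` makes `x ↦ C * x ^ 2` send `exp (-2 ^ m) / C` to `exp (-2 ^ (m + 1)) /
  -- C`; the start is `m = 0`.
  obtain ⟨l₀, hl₀⟩ := eventually_atTop.1 ((hinit (Real.exp (-1) / C) (by positivity)).and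
    (eventually_ne_atTop 0))
  refine ⟨l₀, fun m => ?_⟩
  induction m with
  | zero => intro i _; simpa using (hl₀ (l₀ + i) (by omega)).1
  | succ m ih =>
    intro i hi
    obtain ⟨i, rfl⟩ := Nat.exists_eq_add_of_le' (show K ≤ i by nlinarith)
    have hi' : m * K ≤ i := by rw [Nat.succ_mul] at hi; omega
    have h := hstep (l₀ + i) (hl₀ _ (by omega)).2 (Real.exp (-2 ^ m) / C)
      fun j _ => by rw [add_assoc]; exact ih (i + j) (by omega)
    rw [← add_assoc]
    refine h.mono (fun _ => le_rfl) (le_of_eq ?_)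
    rw [div_pow, ← Real.exp_nat_mul, pow_succ]
    field_simp
    congr 1
    push_cast
    ring

/-- Here every branch must be good, so the probability grows by `d * (1 + lam)` per level, harmless
against a doubly exponential tail. -/
theorem TailBound.iterate_contract {γ ε₀ ε x : ℝ} {l : ℕ} (hl : l ≠ 0) (hγ0 : 0 < γ) (hγ1 : γ < 1)
    (hε : 0 < ε) (hεε₀ : ε ≤ ε₀) (hcontr : ∀ t ≤ ε₀, ∀ (n : ℕ) (V : Fin d → ℝ),
      (∀ i, |V i - cycleLog c n| ≤ t * cycleScale c n) →
        |logVacMap lam (∑ i, V i) - cycleLog c (n + 1)| ≤ γ * t * cycleScale c (n + 1))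
    (h : TailBound d lam c l (fun n => ε * cycleScale c n) x) (m : ℕ) :
    TailBound d lam c (l + m) (fun n => γ ^ m * ε * cycleScale c n) ((d * (1 + lam)) ^ m * x) := by
  induction m with
  | zero => simpa using h
  | succ m ih =>
    refine (ih.contract (t' := fun n => γ * (γ ^ m * ε) * cycleScale c n) (by omega)
      fun n V hV => hcontr _ ?_ n V hV).mono (fun n => le_of_eq (by ring)) (le_of_eq (by ring))
    exact (mul_le_of_le_one_left hε.le (pow_le_one₀ hγ0.le hγ1.le)).trans hεε₀

/-- The logarithm does not shrink distances on `(0, 1]`. -/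
theorem abs_condVac_sub_le (hc : AttractingCycle d lam c) {l : ℕ} (hl : l ≠ 0) (n : ℕ)
    (σ : TreeVertex d → Bool) :
    |condVac d lam l σ - c n| ≤ |logVac d lam l σ - cycleLog c n| := by
  have h0 : ∀ {x y : ℝ}, 0 < x → x ≤ y → y ≤ 1 → y - x ≤ Real.log y - Real.log x := by
    intro x y hx hxy hy
    have hy0 := hx.trans_le hxy
    have h := Real.log_le_sub_one_of_pos (div_pos hx hy0)
    rw [Real.log_div hx.ne' hy0.ne'] at h
    have h1 : y - x ≤ 1 - x / y := by
      rw [show 1 - x / y = (y - x) / y by field_simp, le_div_iff₀ hy0]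
      nlinarith
    linarith
  have hU := condVac_pos (lam := lam) hl σ
  have hU1 := condVac_le_one (lam := lam) l σ
  rw [logVac, cycleLog, abs_sub_comm (-Real.log _)]
  rcases le_total (condVac d lam l σ) (c n) with h | h
  · rw [abs_sub_comm, abs_of_nonneg (sub_nonneg.2 h)]
    exact (h0 hU h (hc.lt_one n).le).trans ((le_of_eq (by ring)).trans (neg_le_abs _))
  · rw [abs_of_nonneg (sub_nonneg.2 h)]
    exact (h0 (hc.pos n) h hU1).trans ((le_of_eq (by ring)).trans (le_abs_self _))

theorem eventually_pow_half_lt {γ : ℝ} (hγ0 : 0 < γ) (hγ1 : γ < 1) (ε : ℝ) :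
    ∃ ζ : ℝ, 0 < ζ ∧ ∀ᶠ l : ℕ in atTop, γ ^ (l / 2) * ε < Real.exp (-(ζ * l)) := by
  have hlog : Real.log γ < 0 := Real.log_neg hγ0 hγ1
  -- Half the true decay rate of `γ ^ (l / 2)`; the slack absorbs `ε` and the rounding of `l / 2`.
  refine ⟨-Real.log γ / 4, by linarith, ?_⟩
  have hlim : Tendsto (fun l : ℕ => Real.exp (-Real.log γ / 4 * l)) atTop atTop :=
    Real.tendsto_exp_atTop.comp
      (tendsto_natCast_atTop_atTop.const_mul_atTop (by linarith))
  filter_upwards [hlim.eventually_gt_atTop (|ε| / γ)] with l hl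
  rw [div_lt_iff₀ hγ0] at hl
  have h1 : γ ^ (l / 2) = Real.exp (Real.log γ * (l / 2 : ℕ)) := by
    rw [← Real.exp_log (pow_pos hγ0 _), Real.log_pow, mul_comm]
  have h2 : (l : ℝ) / 2 - 1 ≤ (l / 2 : ℕ) := by
    have : l ≤ 2 * (l / 2) + 2 := by omega
    have : (l : ℝ) ≤ 2 * (l / 2 : ℕ) + 2 := by exact_mod_cast this
    linarith
  have h3 : γ ^ (l / 2) ≤ Real.exp (Real.log γ * (l / 2 - 1)) := by
    rw [h1]
    exact Real.exp_le_exp.2 (mul_le_mul_of_nonpos_left h2 hlog.le)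
  calc γ ^ (l / 2) * ε ≤ γ ^ (l / 2) * |ε| := by gcongr; exact le_abs_self ε
    _ ≤ Real.exp (Real.log γ * (l / 2 - 1)) * |ε| := by gcongr
    _ < Real.exp (Real.log γ * (l / 2 - 1)) * (Real.exp (-Real.log γ / 4 * l) * γ) := by gcongr
    _ = Real.exp (-(-Real.log γ / 4 * l)) := by
      nth_rewrite 3 [← Real.exp_log hγ0]
      rw [← Real.exp_add, ← Real.exp_add]
      congr 1; ring

theorem eventually_doubly_exponential (K l₀ : ℕ) (hK : K ≠ 0) {C D : ℝ} (hC : 1 ≤ C) (hD : 1 ≤ D) :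
    ∃ ζ : ℝ, 0 < ζ ∧ ∀ᶠ l : ℕ in atTop,
      D ^ (l / 2) * (Real.exp (-2 ^ ((l - l / 2 - l₀) / K)) / C) ≤
        Real.exp (-Real.exp (ζ * l)) := by
  have hK0 : (0 : ℝ) < K := by exact_mod_cast Nat.pos_of_ne_zero hK
  have hlog2 : 0 < Real.log 2 := Real.log_pos one_lt_two
  -- With `z = exp (ζ * l)`, the power `2 ^ (l / (2 * K))` is `z ^ 2`; the constant `a` absorbs `l₀`
  -- and the rounding.
  set ζ := Real.log 2 / (4 * K) with hζ
  have hζ0 : 0 < ζ := by positivity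
  set a := Real.exp (-(Real.log 2 * (l₀ / K + 1))) with ha
  have ha0 : 0 < a := Real.exp_pos _
  refine ⟨ζ, hζ0, ?_⟩
  have hlin : Tendsto (fun l : ℕ => ζ * (l : ℝ)) atTop atTop :=
    tendsto_natCast_atTop_atTop.const_mul_atTop hζ0
  have hexp := Real.tendsto_exp_atTop.comp hlin
  have hdiv := (Real.tendsto_exp_div_pow_atTop 1).comp hlin
  filter_upwards [hexp.eventually_ge_atTop (2 / a), hdiv.eventually_ge_atTop (Real.log D / ζ),
    eventually_ge_atTop (2 * l₀ + 1)] with l hl1 hl2 hl3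
  simp only [Function.comp_apply, pow_one] at hl1 hl2
  have hl0 : (0 : ℝ) < l := by exact_mod_cast (by omega : 0 < l)
  rw [div_le_iff₀ ha0] at hl1
  rw [div_le_div_iff₀ hζ0 (by positivity)] at hl2
  have hl2' : l * Real.log D ≤ Real.exp (ζ * l) := by
    refine le_of_mul_le_mul_right ?_ hζ0
    linarith
  set z := Real.exp (ζ * l) with hz
  have hz0 : 0 < z := Real.exp_pos _
  have hlogD : 0 ≤ Real.log D := Real.log_nonneg hD
  have hpow : a * z ^ 2 ≤ 2 ^ ((l - l / 2 - l₀) / K) := by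
    have h2 : (2 : ℝ) ^ ((l - l / 2 - l₀) / K) =
        Real.exp (Real.log 2 * ((l - l / 2 - l₀) / K : ℕ)) := by
      rw [mul_comm, Real.exp_nat_mul, Real.exp_log two_pos]
    rw [h2, ha, hz, ← Real.exp_nat_mul, ← Real.exp_add]
    refine Real.exp_le_exp.2 ?_
    have h3 : (l : ℝ) / 2 - l₀ ≤ (l - l / 2 - l₀ : ℕ) := by
      have : l ≤ 2 * (l - l / 2 - l₀) + 2 * l₀ := by omega
      have : (l : ℝ) ≤ 2 * (l - l / 2 - l₀ : ℕ) + 2 * l₀ := by exact_mod_cast this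
      linarith
    have h4 : ((l - l / 2 - l₀ : ℕ) : ℝ) / K - 1 ≤ ((l - l / 2 - l₀) / K : ℕ) := by
      rw [sub_le_iff_le_add, div_le_iff₀ hK0]
      have := (Nat.lt_div_mul_add (a := l - l / 2 - l₀) (Nat.pos_of_ne_zero hK)).le
      have : ((l - l / 2 - l₀ : ℕ) : ℝ) ≤ ((l - l / 2 - l₀) / K : ℕ) * K + K := by
        exact_mod_cast this
      linarith
    have h5 : ((l : ℝ) / 2 - l₀) / K - 1 ≤ ((l - l / 2 - l₀) / K : ℕ) :=
      (sub_le_sub_right (div_le_div_of_nonneg_right h3 hK0.le) 1).trans h4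
    refine le_trans (le_of_eq ?_) (mul_le_mul_of_nonneg_left h5 hlog2.le)
    rw [hζ]
    push_cast
    field_simp
    ring
  have hDpow : D ^ (l / 2) ≤ Real.exp z := by
    rw [← Real.exp_log (pow_pos (by linarith : 0 < D) _), Real.log_pow]
    refine Real.exp_le_exp.2 (le_trans (mul_le_mul_of_nonneg_right ?_ hlogD) hl2')
    exact_mod_cast Nat.div_le_self l 2
  calc D ^ (l / 2) * (Real.exp (-2 ^ ((l - l / 2 - l₀) / K)) / C)
      ≤ Real.exp z * Real.exp (-(a * z ^ 2)) := by
        refine mul_le_mul hDpow ?_ (by positivity) (by positivity)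
        exact (div_le_self (Real.exp_pos _).le hC).trans (Real.exp_le_exp.2 (neg_le_neg hpow))
    -- Once `a * z ≥ 2`, the term `a * z ^ 2` is at least `2 * z`.
    _ ≤ Real.exp (-z) := by
        rw [← Real.exp_add]
        refine Real.exp_le_exp.2 ?_
        nlinarith

/-- Doubly exponential concentration around an attracting cycle, uniformly in the height of the
tree. -/
theorem exists_concentration (hd : d ≠ 0) (hc : AttractingCycle d lam c)
    (hinit : ∀ ε > 0, ∀ δ > 0, ∀ᶠ l in atTop,
      TailBound d lam c l (fun n => ε * cycleScale c n) δ) :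
    ∃ ζ₁ ζ₂ : ℝ, 0 < ζ₁ ∧ 0 < ζ₂ ∧ ∀ᶠ l : ℕ in atTop, ∀ L ≥ l,
      (treeGibbs d lam L : Measure (TreeVertex d → Bool)).real
        {σ | Real.exp (-(ζ₁ * l)) ≤ |condVac d lam l σ - c L|} ≤
          Real.exp (-Real.exp (ζ₂ * l)) := by
  have hd1 : (1 : ℝ) ≤ d := by exact_mod_cast Nat.pos_of_ne_zero hd
  have hlam := lam.coe_nonneg
  obtain ⟨γ, ε₀, hγ0, hγ1, hε₀, hcontr⟩ := hc.exists_contraction hd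
  -- `M` dominates every possible deviation, so the first threshold is exceeded with probability
  -- zero.
  set M := Real.log (1 + lam) + cycleLog c 0 + cycleLog c 1 with hM
  have hlog : 0 ≤ Real.log (1 + lam) := Real.log_nonneg (by linarith)
  have hv0 := hc.cycleLog_pos 0
  have hv1 := hc.cycleLog_pos 1
  obtain ⟨ε, K, t, hε, hεε₀, hK, ht0, htK, hthr⟩ :=
    hc.exists_thresholds hγ0 hγ1 hε₀ hcontr (show 0 ≤ M by positivity)
  have hvle : ∀ n, cycleLog c n ≤ cycleLog c 0 + cycleLog c 1 := by
    intro n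
    induction n using Nat.twoStepInduction with
    | zero => linarith
    | one => linarith
    | more n ih _ => simpa only [cycleLog, hc.period n] using ih
  have hzero : ∀ l ≠ 0, TailBound d lam c l (t 0) 0 := by
    intro l hl L _
    have : {σ | t 0 L < |logVac d lam l σ - cycleLog c L|} = ∅ := by
      refine Set.eq_empty_of_forall_notMem fun σ hσ => absurd hσ (not_lt.2 (le_trans ?_ (ht0 L)))
      have h1 := logVac_nonneg (lam := lam) l σ
      have h2 := logVac_le (lam := lam) hl σ
      have h3 := hc.cycleLog_pos L
      have h4 := hvle L
      rw [abs_le]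
      constructor <;> linarith
    rw [this]; simp
  set C : ℝ := K * ((1 + lam) * d ^ 2) ^ K with hC
  have hC1 : 1 ≤ C := by
    have h1 : 1 ≤ (1 + (lam : ℝ)) * d ^ 2 := by nlinarith [one_le_pow₀ hd1 (n := 2)]
    have h2 : (1 : ℝ) ≤ K := by exact_mod_cast hK
    have h3 := one_le_pow₀ h1 (n := K)
    rw [hC]; nlinarith
  obtain ⟨l₀, hl₀⟩ := TailBound.doubly_exponential (d := d) (lam := lam) (c := c)
    (s := fun n => ε * cycleScale c n) (K := K) (C := C) (by linarith) (hinit ε hε)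
    (fun l hl x hx => (TailBound.iterate hd hl hthr (hzero l hl) hx K le_rfl).mono htK le_rfl)
  obtain ⟨ζ₁, hζ₁, hev₁⟩ := eventually_pow_half_lt hγ0 hγ1 ε
  obtain ⟨ζ₂, hζ₂, hev₂⟩ := eventually_doubly_exponential K l₀ hK.ne' hC1
    (show 1 ≤ d * (1 + (lam : ℝ)) by nlinarith)
  refine ⟨ζ₁, ζ₂, hζ₁, hζ₂, ?_⟩
  filter_upwards [hev₁, hev₂, eventually_ge_atTop (2 * l₀ + 2)] with l h1 h2 h3 L hL
  -- About half of the levels square the probability, the remaining `l / 2` shrink the deviation.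
  have hl : l₀ + (l - l / 2 - l₀) + l / 2 = l := by omega
  have hbound := TailBound.iterate_contract (by omega) hγ0 hγ1 hε hεε₀ hcontr
    (hl₀ ((l - l / 2 - l₀) / K) (l - l / 2 - l₀) (Nat.div_mul_le_self _ _)) (l / 2)
  rw [hl] at hbound
  refine le_trans (measureReal_mono fun σ hσ => ?_) ((hbound L hL).trans h2)
  have h4 : γ ^ (l / 2) * ε * cycleScale c L ≤ γ ^ (l / 2) * ε :=
    mul_le_of_le_one_right (by positivity) (hc.cycleScale_le_one L)
  exact (h4.trans_lt h1).trans_le (hσ.trans (abs_condVac_sub_le hc (by omega) L σ))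

end DoublyExponential

/-! ### Existence of the weak limits along each parity. -/

section WeakLimits

/-- An event depending on finitely many coordinates is open. -/
theorem isOpen_of_finite_dependence {ι : Type*} {A : Set (ι → Bool)} (s : Finset ι)
    (h : ∀ σ ∈ A, ∀ τ, (∀ v ∈ s, τ v = σ v) → τ ∈ A) : IsOpen A := by
  rw [isOpen_iff_mem_nhds]
  intro σ hσ
  have hn : (s : Set ι).pi (fun v => {σ v}) ∈ 𝓝 σ :=
    set_pi_mem_nhds s.finite_toSet fun v _ => (isOpen_discrete _).mem_nhds rfl
  exact mem_of_superset hn fun τ hτ => h σ hσ τ fun v hv => hτ v hv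

theorem isClopen_of_finite_dependence {ι : Type*} {A : Set (ι → Bool)} (s : Finset ι)
    (h : ∀ σ ∈ A, ∀ τ, (∀ v ∈ s, τ v = σ v) → τ ∈ A) : IsClopen A :=
  ⟨⟨isOpen_of_finite_dependence s fun σ hσ τ hτ hA =>
    hσ (h τ hA σ fun v hv => (hτ v hv).symm)⟩, isOpen_of_finite_dependence s h⟩

theorem tendsto_real_of_isClopen {Ω ι : Type*} [MeasurableSpace Ω] [TopologicalSpace Ω]
    [OpensMeasurableSpace Ω] [HasOuterApproxClosed Ω] {F : Filter ι} {u : ι → ProbabilityMeasure Ω}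
    {μ : ProbabilityMeasure Ω} (h : Tendsto u F (𝓝 μ)) {A : Set Ω} (hA : IsClopen A) :
    Tendsto (fun n => (u n : Measure Ω).real A) F (𝓝 ((μ : Measure Ω).real A)) := by
  have h1 := ProbabilityMeasure.tendsto_measure_of_null_frontier_of_tendsto' h
    (E := A) (by rw [hA.frontier_eq]; simp)
  exact (ENNReal.tendsto_toReal (measure_ne_top _ _)).comp h1

/-- Laws on configurations converge weakly as soon as the probabilities of all boxes converge. -/
theorem exists_tendsto_of_boxes {ι : Type*} [Countable ι] {u : ℕ → ProbabilityMeasure (ι → Bool)}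
    (h : ∀ (s : Finset ι) (t : ι → Set Bool),
      ∃ x, Tendsto (fun n => (u n : Measure (ι → Bool)).real ((s : Set ι).pi t)) atTop (𝓝 x)) :
    ∃ μ, Tendsto u atTop (𝓝 μ) := by
  choose x hx using h
  have hclopen : ∀ (s : Finset ι) (t : ι → Set Bool), IsClopen ((s : Set ι).pi t) := fun s t =>
    isClopen_of_finite_dependence s fun σ hσ τ hτ v hv => by rw [hτ v hv]; exact hσ v hv
  have hval : ∀ μ, MapClusterPt μ atTop u → ∀ (s : Finset ι) (t : ι → Set Bool),
      (μ : Measure (ι → Bool)).real ((s : Set ι).pi t) = x s t := by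
    intro μ hμ s t
    obtain ⟨U, hU, hlim⟩ := mapClusterPt_iff_ultrafilter.1 hμ
    exact tendsto_nhds_unique (tendsto_real_of_isClopen hlim (hclopen s t)) ((hx s t).mono_left hU)
  -- Compactness supplies a cluster point; it is unique because boxes form a generating π-system and
  -- all cluster points agree on them.
  obtain ⟨μ, -, hμ⟩ := isCompact_univ (X := ProbabilityMeasure (ι → Bool)) (f := map u atTop)
    (by simp)
  refine ⟨μ, isCompact_univ.le_nhds_of_unique_clusterPt univ_mem fun ν _ hν => ?_⟩
  apply ProbabilityMeasure.toMeasure_injective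
  refine ext_of_generate_finite _ (generateFrom_squareCylinders (α := fun _ : ι => Bool)).symm
    (isPiSystem_squareCylinders (fun _ => MeasurableSpace.isPiSystem_measurableSet)
      fun _ => MeasurableSet.univ (α := Bool)) ?_ (by simp)
  rintro A ⟨s, t, -, rfl⟩
  rw [← measureReal_eq_measureReal_iff]
  exact (hval ν hν s t).trans (hval μ hμ s t).symm

variable {d : ℕ} {lam : ℝ≥0}

open Classical in
/-- The indicator of the box of configurations with `σ v ∈ T v` at all vertices `v`. -/
noncomputable def boxIndicator (T : TreeVertex d → Set Bool) (σ : TreeVertex d → Bool) : ℝ :=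
  if ∀ v, σ v ∈ T v then 1 else 0

open Classical in
/-- The constraints on a branch of the tree, together with a vacant root of that branch. -/
noncomputable def vacantBranch (T : TreeVertex d → Set Bool) (i : Fin d) :
    TreeVertex d → Set Bool := fun v => if v = [] then T [i] ∩ {false} else T (i :: v)

open Classical in
theorem boxIndicator_eq_prod (T : TreeVertex d → Set Bool) (σ : TreeVertex d → Bool) :
    boxIndicator T σ = (if σ [] ∈ T [] then 1 else 0) *
      ∏ i, boxIndicator (fun v => T (i :: v)) (branch σ i) := by
  simp only [boxIndicator, Finset.prod_ite_zero, Finset.prod_const_one]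
  have h : (∀ v, σ v ∈ T v) ↔
      σ [] ∈ T [] ∧ ∀ i ∈ Finset.univ, ∀ v, branch σ i v ∈ T (i :: v) := by
    refine ⟨fun h => ⟨h [], fun i _ v => h (i :: v)⟩, ?_⟩
    rintro ⟨h1, h2⟩ (_ | ⟨i, v⟩)
    · exact h1
    · exact h2 i (Finset.mem_univ i) v
  by_cases h1 : σ [] ∈ T []
  · rw [if_pos h1, one_mul]
    exact if_congr (h.trans (and_iff_right h1)) rfl rfl
  · rw [if_neg h1, zero_mul, if_neg fun hh => h1 (h.1 hh).1]

open Classical in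
theorem rootVacant_mul_boxIndicator (T : TreeVertex d → Set Bool) (i : Fin d)
    (τ : TreeVertex d → Bool) :
    rootVacant τ * boxIndicator (fun v => T (i :: v)) τ = boxIndicator (vacantBranch T i) τ := by
  have h : (∀ v, τ v ∈ vacantBranch T i v) ↔ τ [] = false ∧ ∀ v, τ v ∈ T (i :: v) := by
    constructor
    · intro h
      have h0 := h []
      simp only [vacantBranch, if_true] at h0
      refine ⟨h0.2, fun v => ?_⟩
      by_cases hv : v = []
      · subst hv; exact h0.1
      · simpa [vacantBranch, hv] using h v
    · rintro ⟨h0, h⟩ v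
      by_cases hv : v = []
      · subst hv
        simp only [vacantBranch, if_true]
        exact ⟨h [], h0⟩
      · simpa [vacantBranch, hv] using h v
  cases h0 : τ []
  · rw [rootVacant, h0, if_neg (by simp), one_mul]
    exact (if_congr (h.trans (and_iff_right h0)) rfl rfl).symm
  · have hn : ¬ ∀ v, τ v ∈ vacantBranch T i v := fun hh => by
      rw [(h.1 hh).1] at h0
      exact absurd h0 (by simp)
    rw [rootVacant, h0, if_pos rfl, zero_mul]
    exact (if_neg hn).symm

theorem vacProb_succ_eq_div (lam : ℝ≥0) (L : ℕ) : vacProb d lam (L + 1) =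
    gibbsSum d lam L (fun _ => 1) ^ d / gibbsSum d lam (L + 1) (fun _ => 1) := by
  rw [vacProb, treeMean, gibbsSum_succ_rootVacant]

open Classical in
-- Splitting by the root state expresses a box probability through `vacProb` at the same height and
-- box probabilities one level lower, so limits propagate.
theorem treeMean_succ_boxIndicator (lam : ℝ≥0) (L : ℕ) (T : TreeVertex d → Set Bool) :
    treeMean d lam (L + 1) (boxIndicator T) = vacProb d lam (L + 1) *
      ((if false ∈ T [] then 1 else 0) * ∏ i, treeMean d lam L (boxIndicator fun v => T (i :: v)) +
        (if true ∈ T [] then 1 else 0) * lam *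
          ∏ i, treeMean d lam L (boxIndicator (vacantBranch T i))) := by
  have hZ := gibbsSum_one_pos (d := d) lam L
  have hZ' := gibbsSum_one_pos (d := d) lam (L + 1)
  have h := gibbsSum_succ_prod lam L (fun b => if b ∈ T [] then 1 else 0)
    (fun i => boxIndicator fun v => T (i :: v))
  rw [gibbsSum_congr fun σ => (boxIndicator_eq_prod T σ).symm] at h
  simp only [rootVacant_mul_boxIndicator] at h
  rw [treeMean, h, vacProb_succ_eq_div]
  simp only [treeMean, Finset.prod_div_distrib, Finset.prod_const, Finset.card_univ,
    Fintype.card_fin]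
  field_simp

theorem exists_tendsto_treeMean_succ_boxIndicator {u : ℕ → ℕ} {x : ℝ}
    (hx : Tendsto (fun n => vacProb d lam (u n + 1)) atTop (𝓝 x)) (T : TreeVertex d → Set Bool)
    (h1 : ∀ i, ∃ z, Tendsto (fun n => treeMean d lam (u n) (boxIndicator fun v => T (i :: v)))
      atTop (𝓝 z))
    (h2 : ∀ i, ∃ z, Tendsto (fun n => treeMean d lam (u n) (boxIndicator (vacantBranch T i)))
      atTop (𝓝 z)) :
    ∃ z, Tendsto (fun n => treeMean d lam (u n + 1) (boxIndicator T)) atTop (𝓝 z) := by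
  choose a ha using h1
  choose b hb using h2
  simp only [treeMean_succ_boxIndicator]
  exact ⟨_, hx.mul (((tendsto_finsetProd _ fun i _ => ha i).const_mul _).add
    ((tendsto_finsetProd _ fun i _ => hb i).const_mul _))⟩

/-- Induction on the depth of the constraints, for both parities at once since a branch has height
of the opposite parity. At `l = 0` only the root may be constrained. -/
theorem exists_tendsto_treeMean_boxIndicator {x y : ℝ}
    (hx : Tendsto (fun n => vacProb d lam (2 * n)) atTop (𝓝 x))
    (hy : Tendsto (fun n => vacProb d lam (2 * n + 1)) atTop (𝓝 y)) (l : ℕ)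
    (T : TreeVertex d → Set Bool) (hT : ∀ v ≠ [], l ≤ v.length → T v = Set.univ) :
    (∃ z, Tendsto (fun n => treeMean d lam (2 * n) (boxIndicator T)) atTop (𝓝 z)) ∧
      ∃ z, Tendsto (fun n => treeMean d lam (2 * n + 1) (boxIndicator T)) atTop (𝓝 z) := by
  classical
  induction l generalizing T with
  | zero =>
    have h : ∀ L, treeMean d lam L (boxIndicator T) =
        (if false ∈ T [] then 1 else 0) * vacProb d lam L +
          (if true ∈ T [] then 1 else 0) * (1 + -1 * vacProb d lam L) := by
      intro L
      have he : ∀ σ, boxIndicator T σ = (if false ∈ T [] then 1 else 0) * rootVacant σ +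
          (if true ∈ T [] then 1 else 0) * (1 + -1 * rootVacant σ) := ?_
      · rw [treeMean_congr he, treeMean_add, treeMean_const_mul, treeMean_const_mul, treeMean_add,
          treeMean_const_mul, treeMean_one, vacProb]
      intro σ
      have hb : (∀ v, σ v ∈ T v) ↔ σ [] ∈ T [] := by
        refine ⟨fun h => h [], fun h v => ?_⟩
        by_cases hv : v = []
        · rw [hv]; exact h
        · rw [hT v hv (Nat.zero_le _)]; trivial
      simp only [boxIndicator, hb, rootVacant]
      cases σ [] <;> simp
    simp only [h]
    exact ⟨⟨_, (hx.const_mul _).add (((hx.const_mul _).const_add _).const_mul _)⟩,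
      ⟨_, (hy.const_mul _).add (((hy.const_mul _).const_add _).const_mul _)⟩⟩
  | succ l ih =>
    have h1 := fun i => ih (fun v => T (i :: v)) fun v _ hv => hT _ (by simp) (by simpa using hv)
    have h2 := fun i => ih (vacantBranch T i) fun v hv0 hv => by
      rw [vacantBranch, if_neg hv0]
      exact hT _ (by simp) (by simpa using hv)
    refine ⟨?_, exists_tendsto_treeMean_succ_boxIndicator hy T (fun i => (h1 i).1)
      fun i => (h2 i).1⟩
    have e : ∀ n, 2 * (n + 1) = 2 * n + 1 + 1 := fun n => by ring
    have hx' := (tendsto_add_atTop_iff_nat 1).2 hx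
    simp only [e] at hx'
    obtain ⟨z, hz⟩ := exists_tendsto_treeMean_succ_boxIndicator hx' T (fun i => (h1 i).2)
      fun i => (h2 i).2
    refine ⟨z, (tendsto_add_atTop_iff_nat 1).1 ?_⟩
    simp only [e]
    exact hz

/-- Along heights of fixed parity, the hard-core measures converge weakly as soon as the
probabilities of a vacant root do. -/
theorem exists_tendsto_treeGibbs {x y : ℝ}
    (hx : Tendsto (fun n => vacProb d lam (2 * n)) atTop (𝓝 x))
    (hy : Tendsto (fun n => vacProb d lam (2 * n + 1)) atTop (𝓝 y)) :
    (∃ μ, Tendsto (fun n => treeGibbs d lam (2 * n)) atTop (𝓝 μ)) ∧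
      ∃ μ, Tendsto (fun n => treeGibbs d lam (2 * n + 1)) atTop (𝓝 μ) := by
  classical
  have h : ∀ (s : Finset (TreeVertex d)) (t : TreeVertex d → Set Bool) (L : ℕ),
      (treeGibbs d lam L : Measure (TreeVertex d → Bool)).real ((s : Set (TreeVertex d)).pi t) =
        treeMean d lam L (boxIndicator fun v => if v ∈ s then t v else Set.univ) := by
    intro s t L
    rw [treeGibbs_real]
    refine treeMean_congr fun σ => ?_
    have hσ : (∀ v, σ v ∈ if v ∈ s then t v else Set.univ) ↔
        σ ∈ (s : Set (TreeVertex d)).pi t := by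
      refine forall_congr' fun v => ?_
      by_cases hv : v ∈ s <;> simp [hv]
    simp only [boxIndicator, hσ, Set.indicator, Pi.one_apply]
  have hlim := fun (s : Finset (TreeVertex d)) (t : TreeVertex d → Set Bool) =>
    exists_tendsto_treeMean_boxIndicator hx hy (s.sup List.length + 1)
      (fun v => if v ∈ s then t v else Set.univ) fun v _ hv => if_neg fun hvs => by
        have := Finset.le_sup (f := List.length) hvs
        omega
  constructor
  · refine exists_tendsto_of_boxes fun s t => ?_
    simp only [h]
    exact (hlim s t).1
  · refine exists_tendsto_of_boxes fun s t => ?_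
    simp only [h]
    exact (hlim s t).2

end WeakLimits

/-! ### Passage to the limit and the theorem. -/

section Main

variable {d : ℕ} {lam : ℝ≥0}

theorem isClopen_condVac (l : ℕ) (p : ℝ → Prop) : IsClopen {σ | p (condVac d lam l σ)} :=
  isClopen_of_finite_dependence (treeBall d l) fun σ hσ τ hτ => by
    have h : condVac d lam l τ = condVac d lam l σ :=
      condVac_congr lam fun v hv => hτ v (mem_treeBall.2 hv.le)
    rw [Set.mem_ofPred_eq, h]
    exact hσ

/-- A bound that holds on all tall trees passes to a weak limit. -/
theorem real_le_of_tendsto_treeGibbs {u : ℕ → ℕ} (hu : Tendsto u atTop atTop)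
    {μ : ProbabilityMeasure (TreeVertex d → Bool)}
    (hμ : Tendsto (fun n => treeGibbs d lam (u n)) atTop (𝓝 μ)) {l : ℕ} {p : ℝ → Prop} {x : ℝ}
    (h : ∀ n, l ≤ u n →
      (treeGibbs d lam (u n) : Measure (TreeVertex d → Bool)).real {σ | p (condVac d lam l σ)} ≤ x) :
    (μ : Measure (TreeVertex d → Bool)).real {σ | p (condVac d lam l σ)} ≤ x := by
  refine le_of_tendsto (tendsto_real_of_isClopen hμ (isClopen_condVac l p)) ?_
  filter_upwards [hu.eventually_ge_atTop l] with n hn using h n hn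

end Main

theorem mainTheorem9 (Δ : ℕ) (hΔ : 3 ≤ Δ) (lam : ℝ≥0) (hlam : criticalActivity Δ < (lam : ℝ)) :
    ∃ (μp μm : ProbabilityMeasure (TreeVertex (Δ - 1) → Bool)) (qp qm : ℝ),
      Tendsto (fun n : ℕ => treeGibbs (Δ - 1) lam (2 * n)) atTop (𝓝 μp) ∧
      Tendsto (fun n : ℕ => treeGibbs (Δ - 1) lam (2 * n + 1)) atTop (𝓝 μm) ∧
      Tendsto (fun n : ℕ => rootMarginal (Δ - 1) lam (2 * n)) atTop (𝓝 qp) ∧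
      Tendsto (fun n : ℕ => rootMarginal (Δ - 1) lam (2 * n + 1)) atTop (𝓝 qm) ∧
      ∃ ζ₁ ζ₂ : ℝ, 0 < ζ₁ ∧ 0 < ζ₂ ∧ ∀ᶠ l : ℕ in atTop,
        (μp : Measure (TreeVertex (Δ - 1) → Bool)).real
            {σ | Real.exp (-(ζ₁ * l)) ≤ |condRootMarginal (Δ - 1) lam l σ - qp|}
          ≤ Real.exp (-Real.exp (ζ₂ * l)) ∧
        (μm : Measure (TreeVertex (Δ - 1) → Bool)).real
            {σ | Real.exp (-(ζ₁ * l)) ≤ |condRootMarginal (Δ - 1) lam l σ - qm|}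
          ≤ Real.exp (-Real.exp (ζ₂ * l)) := by
  generalize hΔd : Δ - 1 = d
  obtain rfl : Δ = d + 1 := by omega
  have hd : 2 ≤ d := by omega
  have hd' : (2 : ℝ) ≤ d := by exact_mod_cast hd
  -- The critical activity written in terms of `d = Δ - 1`.
  have hlam' : (d : ℝ) ^ d / ((d : ℝ) - 1) ^ (d + 1) < lam := by
    have h1 : ((d + 1 : ℕ) : ℝ) - 1 = d := by push_cast; ring
    have h2 : ((d + 1 : ℕ) : ℝ) - 2 = d - 1 := by push_cast; ring
    rwa [criticalActivity, h1, h2, Nat.add_sub_cancel] at hlam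
  have hlam0 : 0 < lam := by
    have h : (0 : ℝ) < lam := lt_of_le_of_lt
      (div_nonneg (by positivity) (pow_nonneg (by linarith) _)) hlam'
    exact_mod_cast h
  obtain ⟨α, β, hα0, hα1, hβ0, hβ1, hαβ, hβα, hα, hβ, hlo, hhi, hattr⟩ := exists_cycle hd hlam'
  have hc : AttractingCycle d lam (alternate α β) := by
    refine ⟨fun n => ?_, fun n => ?_, fun n => ?_, fun n => ?_, fun n => ?_⟩ <;>
    by_cases h : Even n <;>
    simp only [alternate, Nat.even_add_one, h, not_true_eq_false, not_false_eq_true, if_true,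
      if_false] <;>
    first
    | assumption
    | (rw [mul_comm (1 - β)]; assumption)
  obtain ⟨ζ₁, ζ₂, hζ₁, hζ₂, hconc⟩ := exists_concentration (by omega) hc
    fun ε hε δ hδ => eventually_tailBound hc hα hβ hlo hhi hε hδ
  have hvp : Tendsto (fun n => vacProb d lam (2 * n)) atTop (𝓝 α) := by
    simp only [vacProb_eq, even_two_mul, if_true]
    exact hα.comp (tendsto_atTop_mono (fun n => by dsimp only [id]; omega) tendsto_id)
  have hvm : Tendsto (fun n => vacProb d lam (2 * n + 1)) atTop (𝓝 β) := by
    simp only [vacProb_eq, Nat.not_even_two_mul_add_one, if_false]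
    exact hβ.comp (tendsto_atTop_mono (fun n => by dsimp only [id]; omega) tendsto_id)
  obtain ⟨⟨μp, hμp⟩, μm, hμm⟩ := exists_tendsto_treeGibbs hvp hvm
  refine ⟨μp, μm, 1 - α, 1 - β, hμp, hμm, ?_, ?_, ζ₁, ζ₂, hζ₁, hζ₂, ?_⟩
  · simpa only [rootMarginal_eq] using hvp.const_sub 1
  · simpa only [rootMarginal_eq] using hvm.const_sub 1
  · filter_upwards [hconc] with l hl
    -- Occupation and vacancy are complementary, so both deviations have the same absolute value.
    have hset : ∀ a, {σ | Real.exp (-(ζ₁ * l)) ≤ |condRootMarginal d lam l σ - (1 - a)|} =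
        {σ | Real.exp (-(ζ₁ * l)) ≤ |condVac d lam l σ - a|} := by
      intro a
      ext σ
      rw [Set.mem_ofPred_eq, Set.mem_ofPred_eq, condRootMarginal_eq hlam0, sub_sub_sub_cancel_left,
        abs_sub_comm]
    rw [hset, hset]
    constructor
    · refine real_le_of_tendsto_treeGibbs (u := fun n => 2 * n)
        (tendsto_atTop_mono (fun n => by dsimp only [id]; omega) tendsto_id) hμp
        (p := fun y => Real.exp (-(ζ₁ * l)) ≤ |y - α|) fun n hn => ?_
      have := hl (2 * n) hn
      rwa [alternate, if_pos (even_two_mul n)] at this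
    · refine real_le_of_tendsto_treeGibbs (u := fun n => 2 * n + 1)
        (tendsto_atTop_mono (fun n => by dsimp only [id]; omega) tendsto_id) hμm
        (p := fun y => Real.exp (-(ζ₁ * l)) ≤ |y - β|) fun n hn => ?_
      have := hl (2 * n + 1) hn
      rwa [alternate, if_neg (Nat.not_even_two_mul_add_one n)] at this
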